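/- Let $1\le p\le\infty$, $1<r<\infty$ and $\kappa\in\mathbb R$. Functions on the circle $\mathbb T$ are $2\pi$-periodic functions with values in $\mathbb C$ (in particular real-valued ones); $\|f\|_p=\big(\frac1{2\pi}\int_{\mathbb T}|f|^p\big)^{1/p}$ for $p<\infty$, $\|f\|_\infty$ is the essential supremum, and $(f*g)(x)=\frac1{2\pi}\int_{\mathbb T}f(t)g(x-t)\,dt$. Let $\lambda:\mathbb R\to\mathbb R\setminus\{0\}$ be a mask of type $(r,\kappa)$, that is, $\lambda$ is even and twice continuously differentiable, and there are a function $F:\mathbb R\to\mathbb R$ and a constant $a_1$ with $\lambda(t)=|t|^{-r}(\log(|t|+1))^{-\kappa}F(\log|t|)$ for all $t\ge1$ and $|F^{(k)}(t)|\le a_1$ for all $t\ge 1$ and $k=0,1,2$. Put $\varphi_\lambda(x)=\sum_{k\in\mathbb Z}\lambda(k)e^{ikx}$ and $$\mathcal H_{\lambda,p}(\mathbb T)=\{f:\ f=\varphi_\lambda*g,\ g\in L^p(\mathbb T)\},\qquad \|f\|_{\mathcal H_{\lambda,p}(\mathbb T)}=\|g\|_p ,$$ where $g$ is uniquely determined by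 $f$. Let $\vartheta:\mathbb R\to\mathbb R$ be twice continuously differentiable with $\vartheta=1$ on $[-\frac12,\frac12]$ and $\vartheta=0$ outside $(-1,1)$. For $m\in\mathbb N=\{1,2,\dots\}$ let $H_m(x)=\sum_{k\in\mathbb Z}\vartheta(k/m)e^{ikx}$, and for $f=\varphi_\lambda*g\in\mathcal H_{\lambda,p}(\mathbb T)$ let $$Q_{m,\lambda}(f)=\frac1{2m+1}\sum_{k=0}^{2m}(H_m*g)\Big(\frac{2\pi k}{2m+1}\Big)\,\varphi_\lambda\Big(\cdot-\frac{2\pi k}{2m+1}\Big).$$ Then there is a constant $c>0$ such that for all $f\in\mathcal H_{\lambda,p}(\mathbb T)$ and all $m\in\mathbb N$ $$\|f-Q_{m,\lambda}(f)\|_p\le c\,m^{-r}(\log (m+1))^{-\kappa}\,\|f\|_{\mathcal H_{\lambda,p}(\mathbb T)},$$ and, if $m\ge2$, also $$\|f-Q_{m,\lambda}(f)\|_p\le c\,m^{-r}(\log m)^{-\kappa}\,\|f\|_{\mathcal H_{\lambda,p}(\mathbb T)}.$$ -/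

import Mathlib

open MeasureTheory AddCircle
open scoped ENNReal

namespace TranslateApprox

/-- The circle `ℝ / 2πℤ`; functions on it are the `2π`-periodic functions on `ℝ`. -/
abbrev Torus : Type := AddCircle (2 * Real.pi)

instance fact_two_pi_pos : Fact (0 < 2 * Real.pi) := ⟨Real.two_pi_pos⟩

/-- The normalized measure `dx / 2π` on the circle. -/
noncomputable abbrev haar : Measure Torus := haarAddCircle

/-- `L^p` of the circle with respect to `dx / 2π`, so that its norm is
`((2π)⁻¹ ∫ |f|^p)^(1/p)` for `p < ∞` and the essential supremum for `p = ∞`. -/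
noncomputable abbrev LpTorus (p : ℝ≥0∞) : AddSubgroup (Torus →ₘ[haar] ℂ) := Lp ℂ p haar

/-- The convolution `(f * g)(x) = (2π)⁻¹ ∫ f(t) g(x - t) dt` of two functions on the circle. -/
noncomputable def conv (f g : Torus → ℂ) : Torus → ℂ :=
  convolution f g (ContinuousLinearMap.mul ℂ ℂ) haar

/-- `φ_lam(x) = ∑_{k ∈ ℤ} lam(k) e^{ikx}`. -/
noncomputable def phi (lam : ℝ → ℝ) (x : Torus) : ℂ :=
  ∑' k : ℤ, (lam k : ℂ) * fourier k x

/-- `f = φ_lam * g`. -/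
def IsGenerator (lam : ℝ → ℝ) {p : ℝ≥0∞} (f g : LpTorus p) : Prop :=
  (f : Torus → ℂ) =ᵐ[haar] conv (phi lam) g

/-- The space of all `f = φ_lam * g` with `g ∈ L^p`. -/
def hSpace (lam : ℝ → ℝ) (p : ℝ≥0∞) : Set (LpTorus p) :=
  {f | ∃ g : LpTorus p, IsGenerator lam f g}

open Classical in
/-- The function `g ∈ L^p` with `f = φ_lam * g`, for `f ∈ hSpace lam p`. It is unique when
`lam` is summable and nonvanishing on `ℤ`, by `IsGenerator.unique` below. -/
noncomputable def generator (lam : ℝ → ℝ) {p : ℝ≥0∞} (f : LpTorus p) : LpTorus p :=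
  if h : f ∈ hSpace lam p then h.choose else 0

/-- The norm `‖f‖ = ‖g‖_p`, where `f = φ_lam * g`. -/
noncomputable def hNorm (lam : ℝ → ℝ) {p : ℝ≥0∞} (f : LpTorus p) : ℝ :=
  ‖generator lam f‖

/-- A twice continuously differentiable `θ : ℝ → ℝ` that is `1` on `[-1/2, 1/2]` and
`0` outside `(-1, 1)`. -/
structure IsCutoff (θ : ℝ → ℝ) : Prop where
  contDiff : ContDiff ℝ 2 θ
  eq_one : ∀ x ∈ Set.Icc (-(1 / 2) : ℝ) (1 / 2), θ x = 1
  eq_zero : ∀ x ∉ Set.Ioo (-1 : ℝ) 1, θ x = 0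

/-- `H_m(x) = ∑_{k ∈ ℤ} θ(k/m) (lam(k)/beta(k)) e^{ikx}`. -/
noncomputable def kernelH (θ lam beta : ℝ → ℝ) (m : ℕ) (x : Torus) : ℂ :=
  ∑' k : ℤ, ((θ (k / m) * (lam k / beta k) : ℝ) : ℂ) * fourier k x

/-- `V_m(g) = H_m * g`. -/
noncomputable def opV (θ lam beta : ℝ → ℝ) (m : ℕ) (g : Torus → ℂ) : Torus → ℂ :=
  conv (kernelH θ lam beta m) g

/-- The node `2πk / (2m+1)` on the circle. -/
noncomputable def node (m k : ℕ) : Torus :=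
  ((2 * Real.pi * k / (2 * m + 1) : ℝ) : Torus)

/-- The operator
`Q_{m,beta}(f) = (2m+1)⁻¹ ∑_{k=0}^{2m} V_m(g)(x_k) φ_beta(· - x_k)`, with `f = φ_lam * g` and
`x_k = 2πk/(2m+1)`. -/
noncomputable def opQ (θ lam beta : ℝ → ℝ) (m : ℕ) {p : ℝ≥0∞} (f : LpTorus p) (x : Torus) : ℂ :=
  1 / (2 * m + 1) * ∑ k ∈ Finset.range (2 * m + 1),
    opV θ lam beta m (generator lam f) (node m k) * phi beta (x - node m k)

/-- Masks of type `(r, κ)`. The representation determines `F` on `[0, ∞)` and makes it twice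
continuously differentiable on `(0, ∞)`, so the derivatives below are genuine. -/
structure IsMask (r κ : ℝ) (f : ℝ → ℝ) : Prop where
  even : Function.Even f
  contDiff : ContDiff ℝ 2 f
  decay : ∃ F : ℝ → ℝ, ∃ a : ℝ,
    (∀ t : ℝ, 1 ≤ t → f t = |t| ^ (-r) * Real.log (|t| + 1) ^ (-κ) * F (Real.log |t|)) ∧
    ∀ k : ℕ, k ≤ 2 → ∀ t : ℝ, 1 ≤ t → |iteratedDeriv k F t| ≤ a

/-- The values of a mask of type `(r, κ)`, `r > 1`, at the integers are summable, so that
`phi` is given by an absolutely convergent series. -/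
theorem IsMask.summable {r κ : ℝ} (hr : 1 < r) {f : ℝ → ℝ} (hf : IsMask r κ f) :
    Summable fun k : ℤ => f k := by
  obtain ⟨F, a, hF, ha⟩ := hf.decay
  have hlog : (fun t : ℝ => Real.log (t + 1) ^ (-κ)) =O[Filter.atTop]
      fun t : ℝ => (t + 1) ^ ((r - 1) / 2) :=
    ((isLittleO_log_rpow_rpow_atTop (-κ) (by linarith : 0 < (r - 1) / 2)).comp_tendsto
      (Filter.tendsto_atTop_add_const_right _ 1 Filter.tendsto_id)).isBigO
  have hO : (fun t : ℝ => f t) =O[Filter.atTop] fun t : ℝ => t ^ (-((r + 1) / 2)) := by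
    obtain ⟨C, hC⟩ := hlog.bound
    refine Asymptotics.IsBigO.of_bound (|C| * 2 ^ ((r - 1) / 2) * |a|) ?_
    filter_upwards [hC, Filter.eventually_ge_atTop (Real.exp 1)] with t ht hte
    have h1 : 1 ≤ t := le_trans (Real.one_le_exp zero_le_one) hte
    have h0 : 0 < t := by linarith
    have hlt : 1 ≤ Real.log t := (Real.le_log_iff_exp_le h0).2 hte
    have hFa : |F (Real.log t)| ≤ |a| := by
      simpa using (ha 0 (by norm_num) _ hlt).trans (le_abs_self a)
    rw [hF t h1, abs_of_pos h0, norm_mul, norm_mul]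
    have hb : ‖(t + 1) ^ ((r - 1) / 2)‖ ≤ 2 ^ ((r - 1) / 2) * t ^ ((r - 1) / 2) := by
      rw [Real.norm_of_nonneg (by positivity), ← Real.mul_rpow (by norm_num) h0.le]
      exact Real.rpow_le_rpow (by positivity) (by linarith) (by linarith)
    have hl : ‖Real.log (t + 1) ^ (-κ)‖ ≤ |C| * (2 ^ ((r - 1) / 2) * t ^ ((r - 1) / 2)) :=
      ht.trans (mul_le_mul (le_abs_self C) hb (norm_nonneg _) (abs_nonneg _))
    rw [Real.norm_of_nonneg (by positivity : 0 ≤ t ^ (-r)),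
      Real.norm_of_nonneg (by positivity : 0 ≤ t ^ (-((r + 1) / 2))), Real.norm_eq_abs (F _)]
    calc t ^ (-r) * ‖Real.log (t + 1) ^ (-κ)‖ * |F (Real.log t)|
        ≤ t ^ (-r) * (|C| * (2 ^ ((r - 1) / 2) * t ^ ((r - 1) / 2))) * |a| := by gcongr
      _ = |C| * 2 ^ ((r - 1) / 2) * |a| * (t ^ (-r) * t ^ ((r - 1) / 2)) := by ring
      _ = _ := by
        rw [← Real.rpow_add h0]; congr 2; ring
  have hnat : Summable fun n : ℕ => f n :=
    summable_of_isBigO_nat (Real.summable_nat_rpow.2 (by linarith : -((r + 1) / 2) < -1))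
      (hO.comp_tendsto tendsto_natCast_atTop_atTop)
  refine Summable.of_nat_of_neg (by simpa using hnat) ?_
  simpa [hf.even _] using hnat

theorem norm_fourier_apply (k : ℤ) (x : Torus) : ‖(fourier k x : ℂ)‖ = 1 := by
  rw [fourier_apply, Circle.norm_coe]

/-- The Fourier coefficients of `φ_lam * g` are `lam(n) ĝ(n)`. -/
theorem fourierCoeff_conv_phi {lam : ℝ → ℝ} (hs : Summable fun k : ℤ => lam k)
    {g : Torus → ℂ} (hg : Integrable g haar) (n : ℤ) :
    fourierCoeff (conv (phi lam) g) n = lam n * fourierCoeff g n := by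
  have hsn : Summable fun k : ℤ => |lam k| := hs.abs
  have hconv : ∀ x, conv (phi lam) g x =
      ∑' k : ℤ, (lam k : ℂ) * fourierCoeff g k * fourier k x := by
    intro x
    have h1 : conv (phi lam) g x =
        ∫ t, ∑' k : ℤ, (lam k : ℂ) * fourier k (x - t) * g t ∂haar := by
      rw [conv, convolution_eq_swap]
      refine integral_congr_ae (Filter.Eventually.of_forall fun t => ?_)
      simp only [ContinuousLinearMap.mul_apply', phi]
      rw [tsum_mul_right]
    have hint : ∀ k : ℤ, Integrable (fun t => (lam k : ℂ) * fourier k (x - t) * g t) haar := by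
      intro k
      refine hg.bdd_mul (c := |lam k|) ?_ ?_
      · exact (by fun_prop : Continuous fun t : Torus =>
          (lam k : ℂ) * fourier k (x - t)).aestronglyMeasurable
      · exact Filter.Eventually.of_forall fun t => by
          simp only [norm_mul, norm_fourier_apply]; simp
    rw [h1, ← integral_tsum_of_summable_integral_norm hint]
    · refine tsum_congr fun k => ?_
      have : ∀ t, (lam k : ℂ) * fourier k (x - t) * g t =
          ((lam k : ℂ) * fourier k x) * (fourier (-k) t • g t) := by
        intro t
        have : (fourier k (x - t) : ℂ) = fourier k x * fourier (-k) t := by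
          simp [fourier_apply, sub_eq_add_neg, toCircle_add]
        rw [this, smul_eq_mul]; ring
      simp_rw [this]
      rw [integral_const_mul, fourierCoeff]; ring
    · have : ∀ k : ℤ, ∫ t, ‖(lam k : ℂ) * fourier k (x - t) * g t‖ ∂haar =
          |lam k| * ∫ t, ‖g t‖ ∂haar := by
        intro k
        rw [← integral_const_mul]
        congr 1; ext t; simp only [norm_mul, norm_fourier_apply]; simp
      simp_rw [this]
      exact hsn.mul_right _
  have hbound : ∀ k : ℤ, ‖fourierCoeff g k‖ ≤ ∫ t, ‖g t‖ ∂haar := by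
    intro k
    refine (norm_integral_le_integral_norm _).trans (le_of_eq ?_)
    congr 1; ext t; simp only [norm_smul, norm_fourier_apply]; simp
  have hfun : conv (phi lam) g =
      fun x => ∑' k : ℤ, (lam k : ℂ) * fourierCoeff g k * fourier k x := funext hconv
  rw [hfun, fourierCoeff]
  have hint : ∀ k : ℤ, Integrable
      (fun t : Torus => fourier (-n) t • ((lam k : ℂ) * fourierCoeff g k * fourier k t)) haar := by
    intro k
    exact (by fun_prop : Continuous fun t : Torus =>
      fourier (-n) t • ((lam k : ℂ) * fourierCoeff g k * fourier k t)).integrable_of_hasCompactSupport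
        (HasCompactSupport.of_compactSpace _)
  have h2 : ∀ t : Torus, fourier (-n) t • ∑' k : ℤ, (lam k : ℂ) * fourierCoeff g k * fourier k t =
      ∑' k : ℤ, fourier (-n) t • ((lam k : ℂ) * fourierCoeff g k * fourier k t) := by
    intro t; simp only [smul_eq_mul]; rw [tsum_mul_left]
  simp_rw [h2]
  rw [← integral_tsum_of_summable_integral_norm hint]
  · have h3 : ∀ k : ℤ, ∫ t : Torus, fourier (-n) t • ((lam k : ℂ) * fourierCoeff g k * fourier k t)
        ∂haar = if k = n then (lam n : ℂ) * fourierCoeff g n else 0 := by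
      intro k
      have : ∀ t : Torus, fourier (-n) t • ((lam k : ℂ) * fourierCoeff g k * fourier k t) =
          ((lam k : ℂ) * fourierCoeff g k) * (fourier (-n) t • fourier k t) := by
        intro t; simp only [smul_eq_mul]; ring
      simp_rw [this]
      rw [integral_const_mul]
      have h4 := congrFun (fourierCoeff_fourier (T := 2 * Real.pi) k) n
      rw [fourierCoeff] at h4
      rw [h4]
      by_cases h : k = n
      · subst h; simp
      · simp [h, Ne.symm h]
    simp_rw [h3]
    simp
  · refine Summable.of_nonneg_of_le (fun k => integral_nonneg fun t => norm_nonneg _)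
      (fun k => ?_) (hsn.mul_right (∫ t, ‖g t‖ ∂haar))
    have : ∀ t : Torus, ‖fourier (-n) t • ((lam k : ℂ) * fourierCoeff g k * fourier k t)‖ =
        |lam k| * ‖fourierCoeff g k‖ := by
      intro t; simp only [norm_smul, norm_mul, norm_fourier_apply]; simp
    simp_rw [this]
    simpa using mul_le_mul_of_nonneg_left (hbound k) (abs_nonneg _)

/-- An integrable function with vanishing Fourier coefficients vanishes almost everywhere. -/
theorem ae_eq_zero_of_fourierCoeff {g : Torus → ℂ} (hg : Integrable g haar)
    (h : ∀ n, fourierCoeff g n = 0) : g =ᵐ[haar] 0 := by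
  have hbdd : ∀ u : C(Torus, ℂ), Integrable (fun t => u t * g t) haar := fun u =>
    hg.bdd_mul (c := ‖u‖) u.continuous.aestronglyMeasurable
      (Filter.Eventually.of_forall fun t => u.norm_coe_le_norm t)
  have hcont : ∀ u : C(Torus, ℂ), ∫ t, u t * g t ∂haar = 0 := by
    let Φ : C(Torus, ℂ) →ₗ[ℂ] ℂ :=
      { toFun := fun u => ∫ t, u t * g t ∂haar
        map_add' := fun u v => by
          simp only [ContinuousMap.add_apply, add_mul]
          exact integral_add (hbdd u) (hbdd v)
        map_smul' := fun c u => by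
          simp only [ContinuousMap.smul_apply, smul_eq_mul, mul_assoc, RingHom.id_apply]
          exact integral_const_mul _ _ }
    let Ψ : C(Torus, ℂ) →L[ℂ] ℂ := Φ.mkContinuous (∫ t, ‖g t‖ ∂haar) fun u => by
      refine (norm_integral_le_integral_norm _).trans ?_
      rw [mul_comm (∫ t, ‖g t‖ ∂haar), ← integral_const_mul]
      refine integral_mono (hbdd u).norm (hg.norm.const_mul _) fun t => ?_
      simp only [norm_mul]
      exact mul_le_mul_of_nonneg_right (u.norm_coe_le_norm t) (norm_nonneg _)
    have hle : Submodule.span ℂ (Set.range (@fourier (2 * Real.pi))) ≤ Ψ.ker := by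
      rw [Submodule.span_le]
      rintro _ ⟨n, rfl⟩
      have := h (-n)
      simp only [fourierCoeff, neg_neg, smul_eq_mul] at this
      exact this
    have hcl := Submodule.topologicalClosure_minimal _ hle Ψ.isClosed_ker
    rw [span_fourier_closure_eq_top] at hcl
    intro u
    exact hcl (Submodule.mem_top : u ∈ _)
  refine ae_eq_zero_of_forall_setIntegral_isClosed_eq_zero hg fun s hs => ?_
  have hδ : ∀ n : ℕ, (0 : ℝ) < 1 / (n + 1) := fun n => Nat.one_div_pos_of_nat
  have hlim : Filter.Tendsto (fun n : ℕ =>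
      ∫ t, (((thickenedIndicator (hδ n) s t : NNReal) : ℝ) : ℂ) * g t ∂haar) Filter.atTop
      (nhds (∫ t, s.indicator g t ∂haar)) := by
    refine tendsto_integral_of_dominated_convergence (fun t => ‖g t‖) ?_ hg.norm ?_ ?_
    · intro n
      refine AEStronglyMeasurable.mul ?_ hg.1
      exact (by fun_prop : Continuous fun t : Torus =>
        (((thickenedIndicator (hδ n) s t : NNReal) : ℝ) : ℂ)).aestronglyMeasurable
    · intro n
      refine Filter.Eventually.of_forall fun t => ?_
      rw [norm_mul]
      refine mul_le_of_le_one_left (norm_nonneg _) ?_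
      simpa using thickenedIndicator_le_one (hδ n) s t
    · refine Filter.Eventually.of_forall fun t => ?_
      have h1 := (tendsto_pi_nhds.1 (thickenedIndicator_tendsto_indicator_closure hδ
        tendsto_one_div_add_atTop_nhds_zero_nat s)) t
      rw [hs.closure_eq] at h1
      have h2 := (((Complex.continuous_ofReal.comp NNReal.continuous_coe).tendsto _).comp h1).mul_const
        (g t)
      have h3 : s.indicator g t =
          (Complex.ofReal ∘ NNReal.toReal) (s.indicator (fun _ => 1) t) * g t := by
        by_cases ht : t ∈ s
        · rw [Set.indicator_of_mem ht, Set.indicator_of_mem ht]; simp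
        · rw [Set.indicator_of_notMem ht, Set.indicator_of_notMem ht]; simp
      rw [h3]
      exact h2
  rw [← integral_indicator hs.measurableSet]
  refine tendsto_nhds_unique hlim ?_
  refine Filter.Tendsto.congr (fun n => ?_) tendsto_const_nhds
  exact (hcont ⟨fun t => (((thickenedIndicator (hδ n) s t : NNReal) : ℝ) : ℂ), by fun_prop⟩).symm

/-- The function `g` in `f = φ_lam * g` is determined by `f`. -/
theorem IsGenerator.unique {lam : ℝ → ℝ} (hs : Summable fun k : ℤ => lam k)
    (h0 : ∀ k : ℤ, lam k ≠ 0) {p : ℝ≥0∞} (hp : 1 ≤ p) {f g₁ g₂ : LpTorus p}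
    (h₁ : IsGenerator lam f g₁) (h₂ : IsGenerator lam f g₂) : g₁ = g₂ := by
  have hi : ∀ g : LpTorus p, Integrable g haar := fun g => (Lp.memLp g).integrable hp
  have hc : ∀ n, fourierCoeff (g₁ : Torus → ℂ) n = fourierCoeff (g₂ : Torus → ℂ) n := by
    intro n
    have h := fourierCoeff_congr_ae (h₁.symm.trans h₂)
    have hn := congrFun h n
    rw [fourierCoeff_conv_phi hs (hi g₁), fourierCoeff_conv_phi hs (hi g₂)] at hn
    exact mul_left_cancel₀ (by exact_mod_cast h0 n) hn
  have hsub : ((g₁ : Torus → ℂ) - (g₂ : Torus → ℂ)) =ᵐ[haar] 0 := by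
    refine ae_eq_zero_of_fourierCoeff ((hi g₁).sub (hi g₂)) fun n => ?_
    have := hc n
    simp only [fourierCoeff, Pi.sub_apply, smul_sub] at this ⊢
    rw [integral_sub ((hi g₁).fourier_smul (-n)) ((hi g₂).fourier_smul (-n)), this, sub_self]
  refine Lp.ext ?_
  filter_upwards [hsub] with t ht
  exact sub_eq_zero.1 ht

end TranslateApprox

/-! The error is an aliasing error. Put `N = 2m + 1`. The discrete sum over the `N` nodes cannot
distinguish frequencies that agree mod `N`, so a frequency `l` of `H_m * g` comes out as the sum of
`lam (l + N j) e^{i(l + N j)x}` over all integers `j`. Hence `Q f - f = ∑_j e^{iNjx} (T_j * g)(x)`,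
where `T_j` has the coefficients `lam (l + N j) θ(l/m)`, minus `lam l` when `j = 0`
(`quadrature_sub_conv_eq_tsum`). The modulations have modulus one, so Young's inequality applied to
`∑_j |T_j|` reduces the theorem, for all `p` at once, to `∑_j ‖T_j‖₁ ≤ C w(m)` with `w(t) = t^{-r}
(log (t+1))^{-κ}`.

An `L¹` norm is controlled by coefficients: for every scale `M > 0`, `‖∑ a_k e^{ikx}‖₁` is at most a
constant times `M⁻¹ ∑ |a_k| + M ∑ |Δ²a_k|` (`lintegral_enorm_trigSeries_le`), and `M = m` is the
right scale here. On the relevant range each derivative of `lam` or of `θ(·/m)` gains a factor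
`1/m`, so `m² Δ²a` satisfies the same bounds as `a` (`exists_shiftedMask_bounds`).

For `j = 0` the coefficients vanish for `|l| ≤ m/2` and are `O(w(m + |l|))`, whose sum is `O(m
w(m))`. For `j ≠ 0` only `|l| < m` matters, and there `|l + N j| ≥ m|j|`, so `‖T_j‖₁` is
`O(w(m|j|))`. Half of the excess `r - 1` absorbs the logarithm, giving `w(m|j|) ≤ C |j|^{-(r+1)/2}
w(m)`, which is summable in `j`. -/

namespace TranslateApprox

/-! ### `L¹` norms of trigonometric series -/

/-- The trigonometric series `∑ a(k) e^{ikx}`. -/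
noncomputable def trigSeries (a : ℤ → ℝ) (x : Torus) : ℂ :=
  ∑' k : ℤ, (a k : ℂ) * fourier k x

/-- The symmetric second difference of a sequence. -/
def secondDiff (a : ℤ → ℝ) (k : ℤ) : ℝ := a (k + 1) - 2 * a k + a (k - 1)

theorem norm_coeff_mul_fourier (c : ℝ) (k : ℤ) (x : Torus) :
    ‖(c : ℂ) * fourier k x‖ = |c| := by
  rw [norm_mul, norm_fourier_apply, mul_one, Complex.norm_real, Real.norm_eq_abs]

theorem summable_coeff_mul_fourier {a : ℤ → ℝ} (ha : Summable a) (x : Torus) :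
    Summable fun k : ℤ => (a k : ℂ) * fourier k x :=
  Summable.of_norm (by simpa only [norm_coeff_mul_fourier] using ha.abs)

theorem norm_trigSeries_le {a : ℤ → ℝ} (ha : Summable a) (x : Torus) :
    ‖trigSeries a x‖ ≤ ∑' k, |a k| := by
  refine (norm_tsum_le_tsum_norm ?_).trans (le_of_eq ?_)
  · simpa only [norm_coeff_mul_fourier] using ha.abs
  · simp only [norm_coeff_mul_fourier]

theorem continuous_trigSeries {a : ℤ → ℝ} (ha : Summable a) : Continuous (trigSeries a) :=
  continuous_tsum (fun k => by fun_prop) ha.abs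
    fun k x => (norm_coeff_mul_fourier (a k) k x).le

theorem trigSeries_shift (a : ℤ → ℝ) (j : ℤ) (x : Torus) :
    trigSeries (fun k => a (k + j)) x = fourier (-j) x * trigSeries a x := by
  rw [trigSeries, trigSeries, ← tsum_mul_left,
    ← (Equiv.addRight j).tsum_eq fun k => fourier (-j) x * ((a k : ℂ) * fourier k x)]
  refine tsum_congr fun k => ?_
  simp only [Equiv.coe_addRight]
  have : (fourier k x : ℂ) = fourier (-j) x * fourier (k + j) x := by
    rw [← fourier_add]; simp
  rw [this]; ring

/-- Summation by parts: an index shift is multiplication by a character. The resulting factor has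
modulus `2 - 2 cos x`, comparable to `x²` on `[-π, π]`, so small second differences force decay away
from `0`. -/
theorem trigSeries_secondDiff {a : ℤ → ℝ} (ha : Summable a) (x : Torus) :
    trigSeries (secondDiff a) x = (fourier (-1) x - 2 + fourier 1 x) * trigSeries a x := by
  have h1 : Summable fun k : ℤ => a (k + 1) := (Equiv.addRight (1 : ℤ)).summable_iff.2 ha
  have h2 : Summable fun k : ℤ => a (k + -1) := (Equiv.addRight (-1 : ℤ)).summable_iff.2 ha
  have e1 := trigSeries_shift a 1 x
  have e2 := trigSeries_shift a (-1) x
  rw [neg_neg] at e2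
  have h3 := (summable_coeff_mul_fourier ha x).mul_left (2 : ℂ)
  rw [add_mul, sub_mul, ← e1, ← e2, trigSeries, trigSeries, trigSeries, trigSeries,
    ← tsum_mul_left, ← (summable_coeff_mul_fourier h1 x).tsum_sub h3,
    ← ((summable_coeff_mul_fourier h1 x).sub h3).tsum_add (summable_coeff_mul_fourier h2 x)]
  refine tsum_congr fun k => ?_
  simp only [secondDiff, ← sub_eq_add_neg]
  push_cast
  ring

theorem norm_fourier_second_diff (x : ℝ) :
    ‖(fourier (-1) (x : Torus) - 2 + fourier 1 (x : Torus) : ℂ)‖ = 2 - 2 * Real.cos x := by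
  have h : (fourier (-1) (x : Torus) - 2 + fourier 1 (x : Torus) : ℂ)
      = ((-(2 - 2 * Real.cos x) : ℝ) : ℂ) := by
    have hpi : (Real.pi : ℂ) ≠ 0 := by exact_mod_cast Real.pi_ne_zero
    rw [fourier_coe_apply, fourier_coe_apply]
    have a1 : 2 * (Real.pi : ℂ) * Complex.I * ((-1 : ℤ) : ℂ) * x / ((2 * Real.pi : ℝ) : ℂ)
        = -x * Complex.I := by push_cast; field_simp
    have a2 : 2 * (Real.pi : ℂ) * Complex.I * ((1 : ℤ) : ℂ) * x / ((2 * Real.pi : ℝ) : ℂ)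
        = x * Complex.I := by push_cast; field_simp
    rw [a1, a2]
    push_cast
    rw [Complex.cos]
    ring
  rw [h, Complex.norm_real, norm_neg, Real.norm_of_nonneg]
  linarith [Real.cos_le_one x]

theorem summable_secondDiff {a : ℤ → ℝ} (ha : Summable a) : Summable (secondDiff a) := by
  have h1 : Summable fun k : ℤ => a (k + 1) := (Equiv.addRight (1 : ℤ)).summable_iff.2 ha
  have h2 : Summable fun k : ℤ => a (k - 1) := (Equiv.subRight (1 : ℤ)).summable_iff.2 ha
  exact (h1.sub (ha.mul_left 2)).add h2

/-- Adds the trivial bound to `N²` times the second-difference bound, using `x² ≤ (π²/4)(2 - 2 cos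
x)` and the crude `π² ≤ 16`. The scale `N` is free. -/
theorem norm_trigSeries_le_decay {a : ℤ → ℝ} (ha : Summable a) {N : ℝ} {x : ℝ}
    (hx : |x| ≤ Real.pi) :
    ‖trigSeries a (x : Torus)‖ ≤
      (∑' k, |a k| + 4 * N ^ 2 * ∑' k, |secondDiff a k|) * (1 + (N * x) ^ 2)⁻¹ := by
  have h0 := norm_trigSeries_le ha (x : Torus)
  have h2 := norm_trigSeries_le (summable_secondDiff ha) (x : Torus)
  rw [trigSeries_secondDiff ha, norm_mul, norm_fourier_second_diff] at h2
  have hc := Real.cos_le_one_sub_mul_cos_sq hx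
  set D := ‖trigSeries a (x : Torus)‖ with hD
  have hD0 : 0 ≤ D := norm_nonneg _
  have hpi : Real.pi ^ 2 ≤ 16 := by nlinarith [Real.pi_le_four, Real.pi_pos]
  have hx2 : x ^ 2 ≤ 4 * (2 - 2 * Real.cos x) := by
    have : (2 : ℝ) / Real.pi ^ 2 * x ^ 2 ≤ 1 - Real.cos x := by linarith
    rw [div_mul_eq_mul_div, div_le_iff₀ (by positivity)] at this
    nlinarith [Real.cos_le_one x]
  rw [← div_eq_mul_inv, le_div_iff₀ (by positivity)]
  have : N ^ 2 * (x ^ 2 * D) ≤ N ^ 2 * (4 * ∑' k, |secondDiff a k|) := by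
    refine mul_le_mul_of_nonneg_left ?_ (sq_nonneg N)
    nlinarith [mul_le_mul_of_nonneg_right hx2 hD0]
  nlinarith

/-- The `L¹` norm of a trigonometric series is controlled by its coefficients and their second
differences. -/
theorem lintegral_enorm_trigSeries_le {a : ℤ → ℝ} (ha : Summable a) {N : ℝ} (hN : 0 < N) :
    ∫⁻ x, ‖trigSeries a x‖ₑ ∂haar ≤
      ENNReal.ofReal (2 * (N⁻¹ * ∑' k, |a k| + N * ∑' k, |secondDiff a k|)) := by
  set B := ∑' k, |a k| + 4 * N ^ 2 * ∑' k, |secondDiff a k| with hB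
  have hs0 : 0 ≤ ∑' k, |a k| := tsum_nonneg fun k => abs_nonneg _
  have hs2 : 0 ≤ ∑' k, |secondDiff a k| := tsum_nonneg fun k => abs_nonneg _
  have hB0 : 0 ≤ B := by positivity
  have h1 : ∫⁻ x, ‖trigSeries a x‖ₑ ∂(volume : Measure Torus) ≤
      ENNReal.ofReal (B * (N⁻¹ * Real.pi)) := by
    -- Over the fundamental interval `(-π, π]` the decay bound applies; its majorant integrates over
    -- the whole line to `B π / N`. Normalizing by `2π` leaves `B / (2N)`.
    rw [← AddCircle.lintegral_preimage (2 * Real.pi) (-Real.pi)]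
    calc ∫⁻ x in Set.Ioc (-Real.pi) (-Real.pi + 2 * Real.pi), ‖trigSeries a (x : Torus)‖ₑ
        ≤ ∫⁻ x in Set.Ioc (-Real.pi) (-Real.pi + 2 * Real.pi),
            ENNReal.ofReal (B * (1 + (N * x) ^ 2)⁻¹) := by
          refine setLIntegral_mono' measurableSet_Ioc fun x hx => ?_
          rw [← ofReal_norm]
          refine ENNReal.ofReal_le_ofReal (norm_trigSeries_le_decay ha ?_)
          rw [abs_le]
          exact ⟨hx.1.le, by linarith [hx.2]⟩
      _ ≤ ∫⁻ x, ENNReal.ofReal (B * (1 + (N * x) ^ 2)⁻¹) := setLIntegral_le_lintegral _ _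
      _ = ENNReal.ofReal (∫ x, B * (1 + (N * x) ^ 2)⁻¹) := by
          rw [ofReal_integral_eq_lintegral_ofReal]
          · exact (integrable_inv_one_add_sq.comp_mul_left' hN.ne').const_mul B
          · exact Filter.Eventually.of_forall fun x => by positivity
      _ = _ := by
          rw [integral_const_mul, Measure.integral_comp_mul_left (fun x => (1 + x ^ 2)⁻¹),
            integral_univ_inv_one_add_sq, abs_of_pos (by positivity), smul_eq_mul]
  rw [AddCircle.volume_eq_smul_haarAddCircle, lintegral_smul_measure, smul_eq_mul] at h1
  have h2 : ∫⁻ x, ‖trigSeries a x‖ₑ ∂haar ≤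
      ENNReal.ofReal (B * (N⁻¹ * Real.pi)) / ENNReal.ofReal (2 * Real.pi) := by
    rw [ENNReal.le_div_iff_mul_le (Or.inl (by simpa using Real.pi_pos))
      (Or.inl ENNReal.ofReal_ne_top), mul_comm]
    exact h1
  refine h2.trans ?_
  rw [← ENNReal.ofReal_div_of_pos (by positivity)]
  refine ENNReal.ofReal_le_ofReal (le_of_eq_of_le (b := N⁻¹ * (B / 2)) ?_ ?_)
  · field_simp
  · rw [hB]
    have : N⁻¹ * ((∑' k, |a k| + 4 * N ^ 2 * ∑' k, |secondDiff a k|) / 2)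
      = N⁻¹ * (∑' k, |a k|) / 2 + 2 * (N * ∑' k, |secondDiff a k|) := by field_simp; ring
    rw [this]
    have : 0 ≤ N⁻¹ * ∑' k, |a k| := by positivity
    linarith

/-- When second differences gain exactly `N⁻²`, both terms of the `L¹` bound are at most `S / N`. -/
theorem lintegral_enorm_trigSeries_le_of_majorant {a M : ℤ → ℝ} {N S : ℝ} (hN : 0 < N)
    (hM : HasSum M S) (h0 : ∀ k, |a k| ≤ M k) (h2 : ∀ k, |secondDiff a k| ≤ M k / N ^ 2) :
    ∫⁻ x, ‖trigSeries a x‖ₑ ∂haar ≤ ENNReal.ofReal (4 * (S / N)) := by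
  have hsa : Summable fun k => |a k| := hM.summable.of_nonneg_of_le (fun _ => abs_nonneg _) h0
  have ha : Summable a := hsa.of_abs
  refine (lintegral_enorm_trigSeries_le ha hN).trans (ENNReal.ofReal_le_ofReal ?_)
  have b0 : ∑' k, |a k| ≤ S := hM.tsum_eq ▸ hsa.tsum_le_tsum h0 hM.summable
  have b2 : ∑' k, |secondDiff a k| ≤ S / N ^ 2 :=
    (hM.div_const (N ^ 2)).tsum_eq ▸
      (summable_secondDiff ha).abs.tsum_le_tsum h2 (hM.div_const _).summable
  have c0 : N⁻¹ * ∑' k, |a k| ≤ N⁻¹ * S := by gcongr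
  have c2 : N * ∑' k, |secondDiff a k| ≤ N * (S / N ^ 2) := by gcongr
  have e0 : N⁻¹ * S = S / N := by field_simp
  have e2 : N * (S / N ^ 2) = S / N := by field_simp
  linarith

/-! ### Young's inequality -/

/-- Young's inequality for a pointwise convolution bound. -/
theorem eLpNorm_le_of_enorm_le_lintegral {p : ℝ≥0∞} (hp : 1 ≤ p) {f g : Torus → ℂ}
    (hg : StronglyMeasurable g) {Φ : Torus → ℝ≥0∞} (hΦ : Measurable Φ)
    (hfin : ∫⁻ t, Φ t ∂haar ≠ ∞)
    (hb : ∀ᵐ x ∂haar, ‖f x‖ₑ ≤ ∫⁻ t, Φ (x - t) * ‖g t‖ₑ ∂haar) :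
    eLpNorm f p haar ≤ (∫⁻ t, Φ t ∂haar) * eLpNorm g p haar := by
  set A := ∫⁻ t, Φ t ∂haar with hA
  have hshift : ∀ x, ∫⁻ t, Φ (x - t) ∂haar = A := fun x => lintegral_sub_left_eq_self Φ x
  have hmeas : ∀ x, Measurable fun t => Φ (x - t) := fun x =>
    hΦ.comp (measurable_const.sub measurable_id)
  rcases eq_or_ne p ∞ with rfl | hpt
  · rw [eLpNorm_exponent_top, eLpNorm_exponent_top]
    refine essSup_le_of_ae_le _ ?_
    filter_upwards [hb] with x hx
    refine hx.trans ?_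
    calc ∫⁻ t, Φ (x - t) * ‖g t‖ₑ ∂haar
        ≤ ∫⁻ t, Φ (x - t) * eLpNormEssSup g haar ∂haar := by
          refine lintegral_mono_ae ?_
          filter_upwards [enorm_ae_le_eLpNormEssSup g haar] with t ht
          gcongr
      _ = A * eLpNormEssSup g haar := by rw [lintegral_mul_const _ (hmeas x), hshift]
  · have hp0 : p ≠ 0 := (zero_lt_one.trans_le hp).ne'
    set q := p.toReal with hq
    have hq1 : 1 ≤ q := by simpa using ENNReal.toReal_mono hpt hp
    have hq0 : 0 < q := by linarith
    have hgm : Measurable fun t => ‖g t‖ₑ := hg.measurable.enorm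
    have hpt' : ∀ᵐ x ∂haar, ‖f x‖ₑ ^ q ≤
        (∫⁻ t, Φ (x - t) * ‖g t‖ₑ ^ q ∂haar) * A ^ (q - 1) := by
      filter_upwards [hb] with x hx
      -- Hölder for the measure with density `Φ(x - ·)`, of total mass `A`: the `L¹` norm of `g` is
      -- at most its `L^q` norm times `A^{1 - 1/q}`.
      have h1 := eLpNorm_le_eLpNorm_mul_rpow_measure_univ
        (μ := haar.withDensity fun t => Φ (x - t)) hp hg.aestronglyMeasurable
      rw [eLpNorm_one_eq_lintegral_enorm, eLpNorm_eq_lintegral_rpow_enorm_toReal hp0 hpt,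
        lintegral_withDensity_eq_lintegral_mul _ (hmeas x) hgm,
        lintegral_withDensity_eq_lintegral_mul _ (hmeas x) (hgm.pow_const _),
        withDensity_apply _ MeasurableSet.univ, Measure.restrict_univ, hshift] at h1
      calc ‖f x‖ₑ ^ q ≤ (∫⁻ t, Φ (x - t) * ‖g t‖ₑ ∂haar) ^ q := by gcongr
        _ ≤ _ := ENNReal.rpow_le_rpow h1 hq0.le
        _ = _ := by
          rw [ENNReal.mul_rpow_of_nonneg _ _ hq0.le, ← ENNReal.rpow_mul, ← ENNReal.rpow_mul]
          congr 1
          · rw [one_div, inv_mul_cancel₀ hq0.ne', ENNReal.rpow_one]; rfl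
          · congr 1
            rw [ENNReal.toReal_one, ← hq]
            field_simp
    rw [eLpNorm_eq_lintegral_rpow_enorm_toReal hp0 hpt,
      eLpNorm_eq_lintegral_rpow_enorm_toReal hp0 hpt, ← hq]
    have hint : ∫⁻ x, ‖f x‖ₑ ^ q ∂haar ≤ A ^ q * ∫⁻ t, ‖g t‖ₑ ^ q ∂haar := by
      have hjoint : Measurable fun z : Torus × Torus => Φ (z.1 - z.2) * ‖g z.2‖ₑ ^ q :=
        (hΦ.comp (measurable_fst.sub measurable_snd)).mul
          ((hgm.comp measurable_snd).pow_const _)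
      calc ∫⁻ x, ‖f x‖ₑ ^ q ∂haar
          ≤ ∫⁻ x, (∫⁻ t, Φ (x - t) * ‖g t‖ₑ ^ q ∂haar) * A ^ (q - 1) ∂haar :=
            lintegral_mono_ae hpt'
        _ = (∫⁻ x, ∫⁻ t, Φ (x - t) * ‖g t‖ₑ ^ q ∂haar ∂haar) * A ^ (q - 1) :=
            -- Finiteness of `A` lets the constant leave the integral; Tonelli then yields one more
            -- factor `A`.
            lintegral_mul_const' _ _ (ENNReal.rpow_ne_top_of_nonneg (by linarith) hfin)
        _ = (∫⁻ t, ∫⁻ x, Φ (x - t) * ‖g t‖ₑ ^ q ∂haar ∂haar) * A ^ (q - 1) := by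
            rw [lintegral_lintegral_swap hjoint.aemeasurable]
        _ = (∫⁻ t, A * ‖g t‖ₑ ^ q ∂haar) * A ^ (q - 1) := by
            congr 1
            refine lintegral_congr fun t => ?_
            have hm : Measurable fun x => Φ (x - t) := hΦ.comp (measurable_id.sub_const t)
            rw [lintegral_mul_const _ hm, lintegral_sub_right_eq_self Φ t]
        _ = A ^ q * ∫⁻ t, ‖g t‖ₑ ^ q ∂haar := by
            rw [lintegral_const_mul _ (hgm.pow_const _), mul_right_comm]
            congr 1
            nth_rewrite 1 [← ENNReal.rpow_one A]
            rw [← ENNReal.rpow_add_of_nonneg _ _ zero_le_one (by linarith)]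
            congr 1; ring
    calc (∫⁻ x, ‖f x‖ₑ ^ q ∂haar) ^ (1 / q)
        ≤ (A ^ q * ∫⁻ t, ‖g t‖ₑ ^ q ∂haar) ^ (1 / q) := by gcongr
      _ = _ := by
        rw [ENNReal.mul_rpow_of_nonneg _ _ (by positivity), ← ENNReal.rpow_mul,
          mul_one_div_cancel hq0.ne', ENNReal.rpow_one]

/-! ### Growth and summation of the weight -/

/-- The rate `t ^ (-r) * (log (t + 1)) ^ (-κ)`. -/
noncomputable def weight (r κ t : ℝ) : ℝ := t ^ (-r) * Real.log (t + 1) ^ (-κ)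

theorem log_add_one_pos {t : ℝ} (ht : 0 < t) : 0 < Real.log (t + 1) :=
  Real.log_pos (by linarith)

theorem weight_pos (r κ : ℝ) {t : ℝ} (ht : 0 < t) : 0 < weight r κ t :=
  mul_pos (Real.rpow_pos_of_pos ht _) (Real.rpow_pos_of_pos (log_add_one_pos ht) _)

/-- Powers of `log (t + 1)` grow more slowly than any power of `t`. -/
theorem exists_log_rpow_le (κ : ℝ) {ε : ℝ} (hε : 0 < ε) :
    ∃ C : ℝ, 0 < C ∧ ∀ x y : ℝ, 1 / 2 ≤ x → x ≤ y →
      Real.log (y + 1) ^ κ ≤ C * (y / x) ^ ε * Real.log (x + 1) ^ κ := by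
  rcases le_or_gt κ 0 with hκ | hκ
  · refine ⟨1, one_pos, fun x y hx hxy => ?_⟩
    have hx0 : 0 < x := by linarith
    have h1 : Real.log (y + 1) ^ κ ≤ Real.log (x + 1) ^ κ :=
      Real.rpow_le_rpow_of_nonpos (log_add_one_pos hx0)
        (Real.log_le_log (by linarith) (by linarith)) hκ
    have h2 : 1 ≤ (y / x) ^ ε := Real.one_le_rpow ((one_le_div hx0).2 hxy) hε.le
    have h3 : 0 ≤ Real.log (x + 1) ^ κ := (Real.rpow_pos_of_pos (log_add_one_pos hx0) _).le
    nlinarith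
  -- From `y + 1 ≤ (y/x)(x + 1)`, `log (y+1) ≤ log (y/x) + log (x+1)`. The first term is at most
  -- `(y/x)^δ / δ`, and `c₀ ≤ log (x+1)` makes this multiplicative; raising to the power `κ` turns
  -- `δ` into `ε`.
  · set δ := ε / κ with hδ
    have hδ0 : 0 < δ := div_pos hε hκ
    set c₀ := Real.log (1 / 2 + 1) with hc₀
    have hc₀0 : 0 < c₀ := log_add_one_pos (by norm_num)
    set B := 1 + 1 / (δ * c₀) with hB
    have hB0 : 0 < B := by positivity
    refine ⟨B ^ κ, Real.rpow_pos_of_pos hB0 _, fun x y hx hxy => ?_⟩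
    have hx0 : 0 < x := by linarith
    have hy0 : 0 < y := by linarith
    have hs1 : 1 ≤ y / x := (one_le_div hx0).2 hxy
    have hs0 : 0 < y / x := by positivity
    have hLx := log_add_one_pos hx0
    have hLc : c₀ ≤ Real.log (x + 1) := Real.log_le_log (by norm_num) (by linarith)
    have hsδ : 1 ≤ (y / x) ^ δ := Real.one_le_rpow hs1 hδ0.le
    have h1 : Real.log (y + 1) ≤ Real.log (y / x) + Real.log (x + 1) := by
      rw [← Real.log_mul hs0.ne' (by linarith)]
      refine Real.log_le_log (by linarith) ?_
      have : y / x * (x + 1) = y + y / x := by field_simp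
      linarith
    have h2 : Real.log (y / x) ≤ (y / x) ^ δ / δ := Real.log_le_rpow_div hs0.le hδ0
    have h3 : (y / x) ^ δ / δ ≤ 1 / (δ * c₀) * (y / x) ^ δ * Real.log (x + 1) := by
      have : (y / x) ^ δ / δ = 1 / (δ * c₀) * (y / x) ^ δ * c₀ := by field_simp
      rw [this]
      gcongr
    have h4 : Real.log (y + 1) ≤ B * (y / x) ^ δ * Real.log (x + 1) := by
      rw [hB]
      nlinarith [mul_le_mul_of_nonneg_right hsδ hLx.le]
    calc Real.log (y + 1) ^ κ ≤ (B * (y / x) ^ δ * Real.log (x + 1)) ^ κ :=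
          Real.rpow_le_rpow (log_add_one_pos hy0).le h4 hκ.le
      _ = B ^ κ * (y / x) ^ ε * Real.log (x + 1) ^ κ := by
          rw [Real.mul_rpow (by positivity) hLx.le, Real.mul_rpow hB0.le (by positivity),
            ← Real.rpow_mul hs0.le, hδ, div_mul_cancel₀ _ hκ.ne']

/-- The logarithm costs `(y/x)^{(r-1)/2}`; the remaining exponent `(r+1)/2` still exceeds `1`, so
the bound is summable. -/
theorem exists_weight_le_rpow {r : ℝ} (κ : ℝ) (hr : 1 < r) :
    ∃ C : ℝ, 0 < C ∧ ∀ x y : ℝ, 1 / 2 ≤ x → x ≤ y →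
      weight r κ y ≤ C * (y / x) ^ (-((r + 1) / 2)) * weight r κ x := by
  obtain ⟨C, hC, h⟩ := exists_log_rpow_le (-κ) (by linarith : 0 < (r - 1) / 2)
  refine ⟨C, hC, fun x y hx hxy => ?_⟩
  have hx0 : 0 < x := by linarith
  have hy0 : 0 < y := by linarith
  have hs0 : 0 < y / x := by positivity
  have e1 : y ^ (-r) = (y / x) ^ (-r) * x ^ (-r) := by
    rw [← Real.mul_rpow hs0.le hx0.le, div_mul_cancel₀ _ hx0.ne']
  have e2 : (y / x) ^ (-((r + 1) / 2)) = (y / x) ^ (-r) * (y / x) ^ ((r - 1) / 2) := by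
    rw [← Real.rpow_add hs0]; congr 1; ring
  calc weight r κ y
      ≤ y ^ (-r) * (C * (y / x) ^ ((r - 1) / 2) * Real.log (x + 1) ^ (-κ)) :=
        mul_le_mul_of_nonneg_left (h x y hx hxy) (by positivity)
    _ = _ := by rw [e1, e2, weight]; ring

/-- A substitute for monotonicity, which can fail near the origin for negative `κ`. The slack `3`
covers `m + |t| ≤ 3|t|` for `|t| ≥ m/2`, as well as unit shifts. -/
theorem exists_weight_comparable {r : ℝ} (κ : ℝ) (hr : 1 < r) :
    ∃ C : ℝ, 0 < C ∧ ∀ x y : ℝ, 1 / 2 ≤ x → 1 / 2 ≤ y → x ≤ 3 * y →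
      weight r κ y ≤ C * weight r κ x := by
  obtain ⟨C₁, hC₁, h₁⟩ := exists_weight_le_rpow κ hr
  obtain ⟨C₂, hC₂, h₂⟩ := exists_log_rpow_le κ one_pos
  refine ⟨max C₁ (3 ^ r * (3 * C₂)), lt_max_of_lt_left hC₁, fun x y hx hy hxy => ?_⟩
  have hx0 : 0 < x := by linarith
  have hy0 : 0 < y := by linarith
  have hwx := weight_pos r κ hx0
  rcases le_total x y with hle | hle
  · refine (h₁ x y hx hle).trans ?_
    have : (y / x) ^ (-((r + 1) / 2)) ≤ 1 :=
      Real.rpow_le_one_of_one_le_of_nonpos ((one_le_div hx0).2 hle) (by linarith)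
    calc C₁ * (y / x) ^ (-((r + 1) / 2)) * weight r κ x ≤ C₁ * 1 * weight r κ x := by gcongr
      _ ≤ _ := by rw [mul_one]; gcongr; exact le_max_left _ _
  · have hq : x / y ≤ 3 := (div_le_iff₀ hy0).2 hxy
    have hLx := log_add_one_pos hx0
    have hLy := log_add_one_pos hy0
    have e1 : y ^ (-r) ≤ 3 ^ r * x ^ (-r) := by
      have : (x / 3) ^ (-r) = 3 ^ r * x ^ (-r) := by
        rw [Real.div_rpow hx0.le (by norm_num), Real.rpow_neg (by norm_num : (0 : ℝ) ≤ 3)]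
        field_simp
      rw [← this]
      exact Real.rpow_le_rpow_of_nonpos (by positivity) (by linarith) (by linarith)
    -- Here `y ≤ x`, so the growth bound is applied to the exponent `+κ` from `y` to `x` and then
    -- inverted.
    have e2 : Real.log (y + 1) ^ (-κ) ≤ 3 * C₂ * Real.log (x + 1) ^ (-κ) := by
      have h := h₂ y x hy hle
      rw [Real.rpow_one] at h
      rw [Real.rpow_neg hLx.le, Real.rpow_neg hLy.le, ← div_eq_mul_inv,
        inv_le_iff_one_le_mul₀ (Real.rpow_pos_of_pos hLy _), div_mul_eq_mul_div,
        one_le_div (Real.rpow_pos_of_pos hLx _)]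
      refine h.trans ?_
      have : C₂ * (x / y) ≤ 3 * C₂ := by nlinarith
      gcongr
    calc weight r κ y ≤ (3 ^ r * x ^ (-r)) * (3 * C₂ * Real.log (x + 1) ^ (-κ)) := by
          unfold weight; gcongr
      _ = 3 ^ r * (3 * C₂) * weight r κ x := by unfold weight; ring
      _ ≤ _ := by gcongr; exact le_max_right _ _

/-- The integral test in telescoping form; it follows from `log (1 - 1/x) ≤ -1/x` and `1 + u ≤ exp
u`. -/
theorem rpow_neg_le_sub {σ x : ℝ} (hσ : 1 < σ) (hx : 1 < x) :
    x ^ (-σ) ≤ (σ - 1)⁻¹ * ((x - 1) ^ (1 - σ) - x ^ (1 - σ)) := by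
  have hx0 : 0 < x := by linarith
  have hu : 0 < 1 - 1 / x := by rw [sub_pos, div_lt_one hx0]; exact hx
  have h1 : 1 + (σ - 1) / x ≤ (1 - 1 / x) ^ (1 - σ) := by
    have hlog : Real.log (1 - 1 / x) ≤ -(1 / x) := by
      have := Real.log_le_sub_one_of_pos hu; linarith
    rw [Real.rpow_def_of_pos hu]
    refine le_trans ?_ (Real.add_one_le_exp _)
    have : (σ - 1) / x = (σ - 1) * (1 / x) := by ring
    rw [this]
    nlinarith
  have e1 : (x - 1) ^ (1 - σ) = (1 - 1 / x) ^ (1 - σ) * x ^ (1 - σ) := by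
    rw [← Real.mul_rpow hu.le hx0.le]; congr 1; field_simp
  have e2 : x ^ (-σ) = x ^ (1 - σ) / x := by
    rw [← Real.rpow_sub_one hx0.ne']; congr 1; ring
  have hσ' : 0 < σ - 1 := by linarith
  have hp : 0 < x ^ (1 - σ) := Real.rpow_pos_of_pos hx0 _
  rw [e1, e2, inv_mul_eq_div, le_div_iff₀ hσ']
  have : x ^ (1 - σ) / x * (σ - 1) = (1 + (σ - 1) / x) * x ^ (1 - σ) - x ^ (1 - σ) := by ring
  rw [this]
  gcongr

theorem sum_range_rpow_neg_le {σ : ℝ} (hσ : 1 < σ) {m : ℝ} (hm : 0 < m) (N : ℕ) :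
    ∑ n ∈ Finset.range N, (m + n + 1) ^ (-σ) ≤ (σ - 1)⁻¹ * m ^ (1 - σ) := by
  have hσ' : 0 < σ - 1 := by linarith
  have h : ∀ N : ℕ, ∑ n ∈ Finset.range N, (m + n + 1) ^ (-σ) ≤
      (σ - 1)⁻¹ * (m ^ (1 - σ) - (m + N) ^ (1 - σ)) := by
    intro N
    induction N with
    | zero => simp
    | succ N ih =>
      rw [Finset.sum_range_succ]
      have hN : (0 : ℝ) ≤ N := N.cast_nonneg
      have := rpow_neg_le_sub hσ (by linarith : 1 < m + N + 1)
      rw [add_sub_cancel_right] at this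
      push_cast
      rw [← add_assoc]
      linear_combination ih + this
  refine (h N).trans ?_
  gcongr
  linarith [Real.rpow_nonneg (by positivity : 0 ≤ m + N) (1 - σ)]

theorem exists_tsum_weight_le {r : ℝ} (κ : ℝ) (hr : 1 < r) :
    ∃ C : ℝ, 0 < C ∧ ∀ m : ℝ, 1 ≤ m →
      ∃ S, HasSum (fun n : ℤ => weight r κ (m + |(n : ℝ)|)) S ∧ S ≤ C * m * weight r κ m := by
  obtain ⟨C₁, hC₁, h₁⟩ := exists_weight_le_rpow κ hr
  obtain ⟨C₂, hC₂, h₂⟩ := exists_weight_comparable κ hr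
  set σ := (r + 1) / 2 with hσdef
  have hσ : 1 < σ := by linarith
  have hσ' : 0 < σ - 1 := by linarith
  refine ⟨(C₂ + 1) * (C₁ * (σ - 1)⁻¹), by positivity, fun m hm => ?_⟩
  have hm0 : 0 < m := by linarith
  have hwm := weight_pos r κ hm0
  -- `u` carries the negative indices and `v` below the nonnegative ones. The telescoping bound
  -- applies to `u`, which starts at `m + 1`; `v` is compared with it term by term.
  set u : ℕ → ℝ := fun n => weight r κ (m + n + 1) with hu
  have hu0 : ∀ n, 0 ≤ u n := fun n => (weight_pos r κ (by positivity)).le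
  have hpart : ∀ N, ∑ n ∈ Finset.range N, u n ≤ C₁ * (σ - 1)⁻¹ * m * weight r κ m := by
    intro N
    have hb : ∀ n : ℕ, u n ≤ C₁ * weight r κ m * m ^ σ * (m + n + 1) ^ (-σ) := by
      intro n
      have hn : (0 : ℝ) ≤ n := n.cast_nonneg
      refine (h₁ m (m + n + 1) (by linarith) (by linarith)).trans (le_of_eq ?_)
      rw [Real.div_rpow (by positivity) hm0.le, Real.rpow_neg hm0.le, div_inv_eq_mul]
      ring
    calc ∑ n ∈ Finset.range N, u n
        ≤ ∑ n ∈ Finset.range N, C₁ * weight r κ m * m ^ σ * (m + n + 1) ^ (-σ) :=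
          Finset.sum_le_sum fun n _ => hb n
      _ = C₁ * weight r κ m * m ^ σ * ∑ n ∈ Finset.range N, (m + n + 1) ^ (-σ) := by
          rw [Finset.mul_sum]
      _ ≤ C₁ * weight r κ m * m ^ σ * ((σ - 1)⁻¹ * m ^ (1 - σ)) := by
          gcongr; exact sum_range_rpow_neg_le hσ hm0 N
      _ = C₁ * (σ - 1)⁻¹ * (m ^ σ * m ^ (1 - σ)) * weight r κ m := by ring
      _ = _ := by rw [← Real.rpow_add hm0]; norm_num
  have hus : Summable u := summable_of_sum_range_le hu0 hpart
  have hut : ∑' n, u n ≤ C₁ * (σ - 1)⁻¹ * m * weight r κ m :=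
    Real.tsum_le_of_sum_range_le hu0 hpart
  set v : ℕ → ℝ := fun n => weight r κ (m + n) with hv
  have hv0 : ∀ n, 0 ≤ v n := fun n => (weight_pos r κ (by positivity)).le
  have hvu : ∀ n, v n ≤ C₂ * u n := fun n => by
    have hn : (0 : ℝ) ≤ n := n.cast_nonneg
    exact h₂ _ _ (by linarith) (by linarith) (by linarith)
  have hvs : Summable v := Summable.of_nonneg_of_le hv0 hvu (hus.mul_left _)
  have hvt : ∑' n, v n ≤ C₂ * ∑' n, u n := by
    rw [← tsum_mul_left]; exact hvs.tsum_le_tsum hvu (hus.mul_left _)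
  refine ⟨∑' n, v n + ∑' n, u n, HasSum.of_nat_of_neg_add_one ?_ ?_, ?_⟩
  · simpa [hv] using hvs.hasSum
  · have : (fun n : ℕ => weight r κ (m + |((-((n : ℤ) + 1) : ℤ) : ℝ)|)) = u := by
      funext n
      have hn : (0 : ℝ) ≤ n + 1 := by positivity
      simp only [hu]
      push_cast
      rw [abs_of_nonpos (by linarith)]
      congr 1; ring
    rw [this]; exact hus.hasSum
  · calc ∑' n, v n + ∑' n, u n ≤ (C₂ + 1) * ∑' n, u n := by linarith
      _ ≤ (C₂ + 1) * (C₁ * (σ - 1)⁻¹ * m * weight r κ m) := by gcongr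
      _ = _ := by ring

/-! ### Derivative bounds for masks -/

theorem hasDerivAt_weight (r κ : ℝ) {t : ℝ} (ht : 0 < t) :
    HasDerivAt (weight r κ)
      (weight r κ t * (-r / t - κ / ((t + 1) * Real.log (t + 1)))) t := by
  have hL := log_add_one_pos ht
  have h1 : HasDerivAt (fun t : ℝ => t ^ (-r)) (-r * t ^ (-r - 1)) t :=
    Real.hasDerivAt_rpow_const (Or.inl ht.ne')
  have h2 : HasDerivAt (fun t : ℝ => Real.log (t + 1)) (1 / (t + 1)) t :=
    ((hasDerivAt_id t).add_const 1).log (by simp only [id]; linarith)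
  have h3 := h2.rpow_const (p := -κ) (Or.inl hL.ne')
  refine (h1.mul h3).congr_deriv ?_
  rw [Real.rpow_sub_one ht.ne', Real.rpow_sub_one hL.ne', weight]
  have : t + 1 ≠ 0 := by linarith
  field_simp
  ring

theorem hasDerivAt_logDeriv_weight (r κ : ℝ) {t : ℝ} (ht : 0 < t) :
    HasDerivAt (fun t => -r / t - κ / ((t + 1) * Real.log (t + 1)))
      (r / t ^ 2 + κ * ((Real.log (t + 1) + 1) / ((t + 1) * Real.log (t + 1)) ^ 2)) t := by
  have hL := log_add_one_pos ht
  have ht1 : t + 1 ≠ 0 := by linarith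
  have h0 : HasDerivAt (fun t : ℝ => t + 1) 1 t := (hasDerivAt_id t).add_const 1
  have h2 : HasDerivAt (fun t : ℝ => Real.log (t + 1)) (1 / (t + 1)) t := h0.log ht1
  have h1 : HasDerivAt (fun t : ℝ => -r / t) ((0 * t - -r * 1) / t ^ 2) t :=
    (hasDerivAt_const t (-r)).div (hasDerivAt_id t) ht.ne'
  have h3 : HasDerivAt (fun t : ℝ => κ / ((t + 1) * Real.log (t + 1))) _ t :=
    (hasDerivAt_const t κ).div (h0.mul h2) (mul_ne_zero ht1 hL.ne')
  refine (h1.sub h3).congr_deriv ?_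
  field_simp
  ring

theorem abs_logDeriv_weight_le {r : ℝ} (κ : ℝ) (hr : 0 < r) {t : ℝ} (ht : 3 ≤ t) :
    |(-r / t - κ / ((t + 1) * Real.log (t + 1)))| ≤ (r + |κ|) / t ∧
    |r / t ^ 2 + κ * ((Real.log (t + 1) + 1) / ((t + 1) * Real.log (t + 1)) ^ 2)| ≤
      2 * (r + |κ|) / t ^ 2 := by
  have ht0 : 0 < t := by linarith
  have hL : 1 ≤ Real.log (t + 1) := by
    rw [Real.le_log_iff_exp_le (by linarith)]
    linarith [Real.exp_one_lt_d9]
  have hden : t ≤ (t + 1) * Real.log (t + 1) := by nlinarith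
  constructor
  · refine (abs_sub _ _).trans ?_
    rw [abs_div, abs_div, abs_neg, abs_of_pos hr, abs_of_pos ht0,
      abs_of_pos (by positivity : 0 < (t + 1) * Real.log (t + 1)), add_div]
    gcongr
  · have h1 : (Real.log (t + 1) + 1) / ((t + 1) * Real.log (t + 1)) ^ 2 ≤ 2 / t ^ 2 := by
      rw [div_le_div_iff₀ (by positivity) (by positivity), mul_pow]
      have : (Real.log (t + 1) + 1) ≤ 2 * Real.log (t + 1) ^ 2 := by nlinarith
      have h2 : t ^ 2 ≤ (t + 1) ^ 2 := by gcongr; linarith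
      calc (Real.log (t + 1) + 1) * t ^ 2 ≤ (2 * Real.log (t + 1) ^ 2) * (t + 1) ^ 2 := by gcongr
        _ = _ := by ring
    refine (abs_add_le _ _).trans ?_
    rw [abs_mul, abs_of_pos (by positivity : 0 < r / t ^ 2),
      abs_of_pos (by positivity : 0 < (Real.log (t + 1) + 1) / ((t + 1) * Real.log (t + 1)) ^ 2)]
    calc r / t ^ 2 + |κ| * ((Real.log (t + 1) + 1) / ((t + 1) * Real.log (t + 1)) ^ 2)
        ≤ r / t ^ 2 + |κ| * (2 / t ^ 2) := by gcongr
      _ ≤ r / t ^ 2 + |κ| * (2 / t ^ 2) + r / t ^ 2 := by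
          have : 0 < r / t ^ 2 := by positivity
          linarith
      _ = _ := by ring

/-- `F` is recovered as `s ↦ f(e^s) / w(e^s)`, so the assumed bounds on its iterated derivatives
concern genuine derivatives. -/
theorem contDiffOn_of_eq_weight_mul {r κ : ℝ} {f F : ℝ → ℝ} (hf : ContDiff ℝ 2 f)
    (hF : ∀ t : ℝ, 1 ≤ t → f t = weight r κ t * F (Real.log t)) :
    ContDiffOn ℝ 2 F (Set.Ioi 0) := by
  have hw : ContDiff ℝ 2 fun s : ℝ => weight r κ (Real.exp s) := by
    rw [contDiff_iff_contDiffAt]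
    intro s
    have h1 : ContDiffAt ℝ 2 (fun s : ℝ => Real.exp s ^ (-r)) s :=
      Real.contDiff_exp.contDiffAt.rpow_const_of_ne (Real.exp_pos s).ne'
    have h2 : ContDiffAt ℝ 2 (fun s : ℝ => Real.log (Real.exp s + 1)) s :=
      (Real.contDiff_exp.contDiffAt.add contDiffAt_const).log (by positivity)
    exact h1.mul (h2.rpow_const_of_ne (log_add_one_pos (Real.exp_pos s)).ne')
  have hquot : ContDiff ℝ 2 fun s : ℝ => f (Real.exp s) / weight r κ (Real.exp s) :=
    (hf.comp Real.contDiff_exp).div hw fun s => (weight_pos r κ (Real.exp_pos s)).ne'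
  refine hquot.contDiffOn.congr fun s hs => ?_
  have h := hF (Real.exp s) (Real.one_le_exp (le_of_lt hs))
  rw [Real.log_exp] at h
  rw [h, mul_div_cancel_left₀ _ (weight_pos r κ (Real.exp_pos s)).ne']

/-- With `q` the logarithmic derivative of `w`, `w' = w q` and `w'' = w (q² + q')`; since `F` is
composed with `log`, every differentiation costs a factor `1/t`. The threshold `3 > e` puts `log t`
in the range where `F` is controlled. -/
theorem deriv_bounds_of_eq_weight_mul {r κ a : ℝ} (hr : 0 < r) {f F : ℝ → ℝ}
    (hf : ContDiff ℝ 2 f) (hF : ∀ t : ℝ, 1 ≤ t → f t = weight r κ t * F (Real.log t))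
    (ha : ∀ t : ℝ, 1 ≤ t → |F t| ≤ a ∧ |deriv F t| ≤ a ∧ |deriv (deriv F) t| ≤ a)
    {t : ℝ} (ht : 3 ≤ t) :
    |f t| ≤ a * weight r κ t ∧
    |deriv f t| ≤ (r + |κ| + 1) * a * weight r κ t / t ∧
    |deriv (deriv f) t| ≤ ((r + |κ|) ^ 2 + 4 * (r + |κ|) + 2) * a * weight r κ t / t ^ 2 := by
  have hFd := contDiffOn_of_eq_weight_mul hf hF
  have hF1 : ∀ s, 0 < s → HasDerivAt F (deriv F s) s := fun s hs =>
    ((hFd.differentiableOn (by norm_num)).differentiableAt (Ioi_mem_nhds hs)).hasDerivAt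
  have hFd' : ContDiffOn ℝ 1 (deriv F) (Set.Ioi 0) :=
    hFd.deriv_of_isOpen isOpen_Ioi (by norm_num)
  have hF2 : ∀ s, 0 < s → HasDerivAt (deriv F) (deriv (deriv F) s) s := fun s hs =>
    ((hFd'.differentiableOn (by norm_num)).differentiableAt (Ioi_mem_nhds hs)).hasDerivAt
  set w := weight r κ with hw
  set q : ℝ → ℝ := fun t => -r / t - κ / ((t + 1) * Real.log (t + 1)) with hq
  set q' : ℝ → ℝ := fun t =>
    r / t ^ 2 + κ * ((Real.log (t + 1) + 1) / ((t + 1) * Real.log (t + 1)) ^ 2) with hq'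
  have hu : ∀ t : ℝ, 1 < t →
      HasDerivAt (fun t => F (Real.log t)) (deriv F (Real.log t) * t⁻¹) t := fun t ht =>
    (hF1 _ (Real.log_pos ht)).comp t (Real.hasDerivAt_log (by linarith))
  have hu1 : ∀ t : ℝ, 1 < t → HasDerivAt (fun t => deriv F (Real.log t) * t⁻¹)
      (deriv (deriv F) (Real.log t) * t⁻¹ * t⁻¹ + deriv F (Real.log t) * -(t ^ 2)⁻¹) t :=
    fun t ht => ((hF2 _ (Real.log_pos ht)).comp t (Real.hasDerivAt_log (by linarith))).mul
      (hasDerivAt_inv (by linarith))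
  have hf1 : ∀ t : ℝ, 1 < t → HasDerivAt f
      (w t * q t * F (Real.log t) + w t * (deriv F (Real.log t) * t⁻¹)) t := by
    intro t ht
    refine ((hasDerivAt_weight r κ (by linarith)).mul (hu t ht)).congr_of_eventuallyEq ?_
    filter_upwards [Ioi_mem_nhds ht] with s hs
    exact hF s (le_of_lt hs)
  have ht1 : 1 < t := by linarith
  have ht0 : 0 < t := by linarith
  have hf2 : HasDerivAt (deriv f)
      ((w t * q t * q t + w t * q' t) * F (Real.log t)
        + w t * q t * (deriv F (Real.log t) * t⁻¹)
        + (w t * q t * (deriv F (Real.log t) * t⁻¹)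
        + w t * (deriv (deriv F) (Real.log t) * t⁻¹ * t⁻¹
          + deriv F (Real.log t) * -(t ^ 2)⁻¹))) t := by
    have hw1 := hasDerivAt_weight r κ ht0
    refine (((hw1.mul (hasDerivAt_logDeriv_weight r κ ht0)).mul (hu t ht1)).add
      (hw1.mul (hu1 t ht1))).congr_of_eventuallyEq ?_
    filter_upwards [Ioi_mem_nhds ht1] with s hs
    exact (hf1 s hs).deriv
  obtain ⟨a0, a1, a2⟩ := ha (Real.log t) (by
    rw [Real.le_log_iff_exp_le ht0]; linarith [Real.exp_one_lt_d9])
  obtain ⟨b1, b2⟩ := abs_logDeriv_weight_le κ hr ht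
  change |q t| ≤ _ at b1
  change |q' t| ≤ _ at b2
  have hwt : 0 < w t := weight_pos r κ ht0
  set Q := r + |κ| with hQ
  have hQ0 : 0 ≤ Q := by positivity
  have ha0 : 0 ≤ a := (abs_nonneg _).trans a0
  set u := F (Real.log t)
  set v := deriv F (Real.log t)
  set z := deriv (deriv F) (Real.log t)
  refine ⟨?_, ?_, ?_⟩
  · rw [hF t (by linarith), abs_mul, abs_of_pos hwt, mul_comm]
    gcongr
  · rw [(hf1 t ht1).deriv]
    calc |w t * q t * u + w t * (v * t⁻¹)|
        ≤ w t * |q t| * |u| + w t * (|v| * t⁻¹) := by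
          refine (abs_add_le _ _).trans (le_of_eq ?_)
          simp only [abs_mul, abs_inv, abs_of_pos hwt, abs_of_pos ht0]
      _ ≤ w t * (Q / t) * a + w t * (a * t⁻¹) := by gcongr
      _ = _ := by field_simp
  · rw [hf2.deriv]
    calc _ ≤ (w t * |q t| * |q t| + w t * |q' t|) * |u| + w t * |q t| * (|v| * t⁻¹)
          + (w t * |q t| * (|v| * t⁻¹) + w t * (|z| * t⁻¹ * t⁻¹ + |v| * (t ^ 2)⁻¹)) := by
          have e : ∀ x y : ℝ, |x + y| ≤ |x| + |y| := abs_add_le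
          refine (e _ _).trans (add_le_add ((e _ _).trans (add_le_add ?_ ?_))
            ((e _ _).trans (add_le_add ?_ ?_)))
          · rw [abs_mul]
            refine mul_le_mul_of_nonneg_right ((e _ _).trans (le_of_eq ?_)) (abs_nonneg _)
            simp only [abs_mul, abs_of_pos hwt]
          · simp only [abs_mul, abs_inv, abs_of_pos hwt, abs_of_pos ht0]; rfl
          · simp only [abs_mul, abs_inv, abs_of_pos hwt, abs_of_pos ht0]; rfl
          · rw [abs_mul, abs_of_pos hwt]
            refine mul_le_mul_of_nonneg_left ((e _ _).trans (le_of_eq ?_)) hwt.le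
            simp only [abs_mul, abs_inv, abs_neg, abs_pow, abs_of_pos ht0]
      _ ≤ (w t * (Q / t) * (Q / t) + w t * (2 * Q / t ^ 2)) * a + w t * (Q / t) * (a * t⁻¹)
          + (w t * (Q / t) * (a * t⁻¹) + w t * (a * t⁻¹ * t⁻¹ + a * (t ^ 2)⁻¹)) := by
          gcongr
      _ = _ := by field_simp; ring

theorem IsMask.exists_deriv_bounds_of_pos {r κ : ℝ} (hr : 0 < r) {f : ℝ → ℝ}
    (hf : IsMask r κ f) :
    ∃ C : ℝ, 0 < C ∧ ∀ t : ℝ, 1 / 2 ≤ t →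
      |f t| ≤ C * weight r κ t ∧ |deriv f t| ≤ C * weight r κ t / t ∧
      |deriv (deriv f) t| ≤ C * weight r κ t / t ^ 2 := by
  obtain ⟨F, a, hF, ha⟩ := hf.decay
  have hf2 := hf.contDiff
  have hF' : ∀ t : ℝ, 1 ≤ t → f t = weight r κ t * F (Real.log t) := fun t ht => by
    have := hF t ht
    rwa [abs_of_pos (by linarith : 0 < t)] at this
  have ha' : ∀ t : ℝ, 1 ≤ t → |F t| ≤ a ∧ |deriv F t| ≤ a ∧ |deriv (deriv F) t| ≤ a := by
    intro t ht
    have h0 := ha 0 (by norm_num) t ht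
    have h1 := ha 1 (by norm_num) t ht
    have h2 := ha 2 (by norm_num) t ht
    rw [iteratedDeriv_zero] at h0
    rw [iteratedDeriv_one] at h1
    rw [iteratedDeriv_succ, iteratedDeriv_one] at h2
    exact ⟨h0, h1, h2⟩
  have hd1 : ContDiff ℝ 1 (deriv f) := ((contDiff_succ_iff_deriv (n := 1)).1 hf2).2.2
  have hd2 : Continuous (deriv (deriv f)) := hd1.continuous_deriv le_rfl
  have hpos : ∀ t ∈ Set.Icc (1 / 2 : ℝ) 3, 0 < t := fun t ht => by linarith [ht.1]
  have hwc : ContinuousOn (weight r κ) (Set.Icc (1 / 2) 3) := fun t ht =>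
    (hasDerivAt_weight r κ (hpos t ht)).continuousAt.continuousWithinAt
  have hw0 : ∀ t ∈ Set.Icc (1 / 2 : ℝ) 3, weight r κ t ≠ 0 := fun t ht =>
    (weight_pos r κ (hpos t ht)).ne'
  -- Below `3` the representation gives no derivative control, but `w` is continuous and nonzero on
  -- `[1/2, 3]`, so compactness suffices. The endpoint `1/2` serves `|t| ≥ m/2` with `m ≥ 1`.
  obtain ⟨C₀, h₀⟩ := isCompact_Icc.exists_bound_of_continuousOn
    (hf2.continuous.continuousOn.div hwc hw0)
  obtain ⟨C₁, h₁⟩ := isCompact_Icc.exists_bound_of_continuousOn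
    ((hd1.continuous.continuousOn.mul continuousOn_id).div hwc hw0)
  obtain ⟨C₂, h₂⟩ := isCompact_Icc.exists_bound_of_continuousOn
    ((hd2.continuousOn.mul (continuousOn_id.pow 2)).div hwc hw0)
  have ha0 : 0 ≤ a := (abs_nonneg _).trans (ha' 1 le_rfl).1
  set Q := r + |κ| with hQ
  have hQ0 : 0 ≤ Q := by positivity
  refine ⟨|C₀| + |C₁| + |C₂| + (Q ^ 2 + 4 * Q + 2) * a + 1, by positivity, fun t ht => ?_⟩
  set C := |C₀| + |C₁| + |C₂| + (Q ^ 2 + 4 * Q + 2) * a + 1 with hC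
  have ht0 : 0 < t := by linarith
  have hwt := weight_pos r κ ht0
  have hQa : 0 ≤ (Q ^ 2 + 4 * Q + 2) * a := by positivity
  rcases le_total t 3 with ht3 | ht3
  · have hm : t ∈ Set.Icc (1 / 2 : ℝ) 3 := ⟨ht, ht3⟩
    have k0 := h₀ t hm
    have k1 := h₁ t hm
    have k2 := h₂ t hm
    simp only [Pi.div_apply, Pi.mul_apply, Pi.pow_apply, id, norm_div, norm_mul, norm_pow,
      Real.norm_eq_abs, abs_of_pos hwt, abs_of_pos ht0] at k0 k1 k2
    rw [div_le_iff₀ hwt] at k0 k1 k2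
    have l0 : C₀ ≤ C := by
      linarith [le_abs_self C₀, abs_nonneg C₁, abs_nonneg C₂]
    have l1 : C₁ ≤ C := by
      linarith [le_abs_self C₁, abs_nonneg C₀, abs_nonneg C₂]
    have l2 : C₂ ≤ C := by
      linarith [le_abs_self C₂, abs_nonneg C₀, abs_nonneg C₁]
    refine ⟨k0.trans (by gcongr), ?_, ?_⟩
    · rw [le_div_iff₀ ht0]; exact k1.trans (by gcongr)
    · rw [le_div_iff₀ (by positivity)]; exact k2.trans (by gcongr)
  · obtain ⟨k0, k1, k2⟩ := deriv_bounds_of_eq_weight_mul hr hf2 hF' ha' ht3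
    have l2 : (Q ^ 2 + 4 * Q + 2) * a ≤ C := by
      linarith [abs_nonneg C₀, abs_nonneg C₁, abs_nonneg C₂]
    have l1 : (Q + 1) * a ≤ C := le_trans (by gcongr ?_ * a; nlinarith) l2
    have l0 : a ≤ C := by
      refine le_trans ?_ l2
      nlinarith
    exact ⟨k0.trans (by gcongr), k1.trans (by gcongr), k2.trans (by gcongr)⟩

theorem IsMask.exists_deriv_bounds {r κ : ℝ} (hr : 0 < r) {f : ℝ → ℝ} (hf : IsMask r κ f) :
    ∃ C : ℝ, 0 < C ∧ ∀ t : ℝ, 1 / 2 ≤ |t| →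
      |f t| ≤ C * weight r κ |t| ∧ |deriv f t| ≤ C * weight r κ |t| / |t| ∧
      |deriv (deriv f) t| ≤ C * weight r κ |t| / |t| ^ 2 := by
  obtain ⟨C, hC, h⟩ := hf.exists_deriv_bounds_of_pos hr
  refine ⟨C, hC, fun t ht => ?_⟩
  have hd1 : ∀ x, deriv f (-x) = -deriv f x := fun x => by
    have : (fun x => f (-x)) = f := funext hf.even
    have h := deriv_comp_neg f x
    rw [this] at h
    rw [h, neg_neg]
  have hd2 : ∀ x, deriv (deriv f) (-x) = deriv (deriv f) x := fun x => by
    have h := deriv_comp_neg (deriv f) x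
    have : (fun x => deriv f (-x)) = fun x => -deriv f x := funext hd1
    rw [this, deriv.fun_neg] at h
    linarith
  rcases abs_choice t with ht' | ht'
  · have := h |t| ht
    rwa [ht'] at this ⊢
  · have := h |t| ht
    rw [ht'] at this ⊢
    rwa [hf.even, hd1, hd2, abs_neg] at this

/-! ### Second differences of the mask times the cutoff -/

theorem IsCutoff.exists_bounds {θ : ℝ → ℝ} (hθ : IsCutoff θ) :
    ∃ T : ℝ, 0 < T ∧ ∀ s, |θ s| ≤ T ∧ |deriv θ s| ≤ T ∧ |deriv (deriv θ) s| ≤ T := by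
  have h1 : ContDiff ℝ 1 (deriv θ) := ((contDiff_succ_iff_deriv (n := 1)).1 hθ.contDiff).2.2
  have hcs : HasCompactSupport θ :=
    HasCompactSupport.intro (isCompact_Icc (a := (-1 : ℝ)) (b := 1)) fun x hx =>
      hθ.eq_zero x fun h => hx (Set.Ioo_subset_Icc_self h)
  obtain ⟨C₀, k₀⟩ := hcs.exists_bound_of_continuous hθ.contDiff.continuous
  obtain ⟨C₁, k₁⟩ := hcs.deriv.exists_bound_of_continuous h1.continuous
  obtain ⟨C₂, k₂⟩ := hcs.deriv.deriv.exists_bound_of_continuous (h1.continuous_deriv le_rfl)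
  refine ⟨max (max C₀ C₁) (max C₂ 1), by positivity, fun s => ⟨?_, ?_, ?_⟩⟩
  · exact (k₀ s).trans (by simp)
  · exact (k₁ s).trans (by simp)
  · exact (k₂ s).trans (by simp)

theorem deriv_eq_zero_of_isOpen {θ : ℝ → ℝ} {U : Set ℝ} (hU : IsOpen U) {c : ℝ}
    (h : ∀ s ∈ U, θ s = c) {s : ℝ} (hs : s ∈ U) : deriv θ s = 0 := by
  have : θ =ᶠ[nhds s] fun _ => c := by
    filter_upwards [hU.mem_nhds hs] with x hx using h x hx
  rw [this.deriv_eq, deriv_const]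

/-- The second symmetric difference is bounded by the second derivative. -/
theorem abs_second_difference_le {h : ℝ → ℝ} (hh : ContDiff ℝ 2 h) {B x : ℝ}
    (hB : ∀ t, |t - x| ≤ 1 → |deriv (deriv h) t| ≤ B) :
    |h (x + 1) - 2 * h x + h (x - 1)| ≤ B := by
  have hd : Differentiable ℝ h := hh.differentiable (by norm_num)
  have hd' : Differentiable ℝ (deriv h) :=
    ((contDiff_succ_iff_deriv (n := 1)).1 hh).2.2.differentiable (by norm_num)
  -- The second difference is a first difference of `h(t+1) - h(t)`, so the mean value inequality is
  -- used twice.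
  have hD : ∀ t, HasDerivAt (fun t => h (t + 1) - h t) (deriv h (t + 1) - deriv h t) t :=
    fun t => ((hd (t + 1)).hasDerivAt.comp_add_const t 1).sub (hd t).hasDerivAt
  have hb : ∀ t ∈ Set.Icc (x - 1) x, ‖deriv (fun t => h (t + 1) - h t) t‖ ≤ B := by
    intro t ht
    rw [(hD t).deriv]
    have := (convex_Icc t (t + 1)).norm_image_sub_le_of_norm_deriv_le (f := deriv h) (C := B)
      (fun s _ => hd' s) (fun s hs => hB s (abs_le.2
        ⟨by linarith [hs.1, ht.1], by linarith [hs.2, ht.2]⟩))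
      (Set.left_mem_Icc.2 (by linarith)) (Set.right_mem_Icc.2 (by linarith))
    simpa using this
  have := (convex_Icc (x - 1) x).norm_image_sub_le_of_norm_deriv_le (C := B)
    (fun s _ => (hD s).differentiableAt) hb
    (Set.left_mem_Icc.2 (by linarith)) (Set.right_mem_Icc.2 (by linarith))
  have e : h (x + 1) - 2 * h x + h (x - 1)
      = h (x + 1) - h x - (h (x - 1 + 1) - h (x - 1)) := by
    rw [sub_add_cancel]; ring
  rw [e]
  simpa using this

/-- The mask shifted by `c` times the cutoff at scale `m` minus the constant `e`. -/
noncomputable def shiftedMask (θ lam : ℝ → ℝ) (e c m t : ℝ) : ℝ :=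
  lam (t + c) * (θ (t / m) - e)

section

variable {θ lam : ℝ → ℝ}

theorem contDiff_shiftedMask (hθ : ContDiff ℝ 2 θ) (hlam : ContDiff ℝ 2 lam) (e c m : ℝ) :
    ContDiff ℝ 2 (shiftedMask θ lam e c m) := by
  unfold shiftedMask
  fun_prop

theorem deriv_deriv_shiftedMask (hθ : ContDiff ℝ 2 θ) (hlam : ContDiff ℝ 2 lam)
    (e c m t : ℝ) :
    deriv (deriv (shiftedMask θ lam e c m)) t =
      deriv (deriv lam) (t + c) * (θ (t / m) - e)
        + 2 * (deriv lam (t + c) * (deriv θ (t / m) / m))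
        + lam (t + c) * (deriv (deriv θ) (t / m) / m / m) := by
  have d : ∀ {h : ℝ → ℝ}, ContDiff ℝ 2 h → Differentiable ℝ h ∧ Differentiable ℝ (deriv h) :=
    fun hh => ⟨hh.differentiable (by norm_num),
      ((contDiff_succ_iff_deriv (n := 1)).1 hh).2.2.differentiable (by norm_num)⟩
  have s : ∀ {h : ℝ → ℝ}, Differentiable ℝ h → ∀ t,
      HasDerivAt (fun t => h (t + c)) (deriv h (t + c)) t := fun hh t =>
    (hh (t + c)).hasDerivAt.comp_add_const t c
  have z : ∀ {h : ℝ → ℝ}, Differentiable ℝ h → ∀ t,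
      HasDerivAt (fun t => h (t / m)) (deriv h (t / m) / m) t := fun {h} hh t => by
    have := (hh (t / m)).hasDerivAt.comp t ((hasDerivAt_id t).div_const m)
    exact this.congr_deriv (by ring)
  have h1 : deriv (shiftedMask θ lam e c m) = fun t =>
      deriv lam (t + c) * (θ (t / m) - e) + lam (t + c) * (deriv θ (t / m) / m) :=
    funext fun t => ((s (d hlam).1 t).mul ((z (d hθ).1 t).sub_const e)).deriv
  rw [h1]
  refine ((((s (d hlam).2 t).mul ((z (d hθ).1 t).sub_const e)).add
    ((s (d hlam).1 t).mul ((z (d hθ).2 t).div_const m))).deriv).trans ?_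
  ring

/-- Derivatives of `lam` gain `1/|t + c| ≤ 2/m`, those of `θ(·/m)` gain `1/m`. The Leibniz terms
give `4(T+1) + 4T + T = 9T + 4`. -/
theorem exists_shiftedMask_bounds {r κ : ℝ} (hr : 0 < r) (hθ : IsCutoff θ)
    (hlam : IsMask r κ lam) :
    ∃ C : ℝ, 0 < C ∧ ∀ m e c t : ℝ, 1 ≤ m → |e| ≤ 1 → m / 2 ≤ |t + c| →
      |shiftedMask θ lam e c m t| ≤ C * weight r κ |t + c| ∧
      |deriv (deriv (shiftedMask θ lam e c m)) t| ≤ C * weight r κ |t + c| / m ^ 2 := by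
  obtain ⟨C, hC, h⟩ := hlam.exists_deriv_bounds hr
  obtain ⟨T, hT, k⟩ := hθ.exists_bounds
  refine ⟨C * (9 * T + 4), by positivity, fun m e c t hm he ht => ?_⟩
  obtain ⟨h0, h1, h2⟩ := h (t + c) (by linarith)
  obtain ⟨k0, k1, k2⟩ := k (t / m)
  have hm0 : 0 < m := by linarith
  have hy0 : 0 < |t + c| := by linarith
  have hw := weight_pos r κ hy0
  have ke : |θ (t / m) - e| ≤ T + 1 := (abs_sub _ _).trans (add_le_add k0 he)
  have i1 : C * weight r κ |t + c| / |t + c| ≤ 2 * (C * weight r κ |t + c|) / m := by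
    rw [div_le_div_iff₀ hy0 hm0]
    nlinarith [mul_pos hC hw]
  have i2 : C * weight r κ |t + c| / |t + c| ^ 2 ≤ 4 * (C * weight r κ |t + c|) / m ^ 2 := by
    rw [div_le_div_iff₀ (by positivity) (by positivity)]
    have : m ^ 2 ≤ 4 * |t + c| ^ 2 := by nlinarith
    nlinarith [mul_pos hC hw]
  set W := C * weight r κ |t + c| with hW
  have hW0 : 0 < W := mul_pos hC hw
  have eW : C * (9 * T + 4) * weight r κ |t + c| = (9 * T + 4) * W := by rw [hW]; ring
  rw [eW]
  constructor
  · rw [shiftedMask, abs_mul]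
    calc |lam (t + c)| * |θ (t / m) - e| ≤ W * (T + 1) := by gcongr
      _ ≤ _ := by nlinarith
  · rw [deriv_deriv_shiftedMask hθ.contDiff hlam.contDiff]
    calc _ ≤ |deriv (deriv lam) (t + c)| * |θ (t / m) - e|
          + 2 * (|deriv lam (t + c)| * (|deriv θ (t / m)| / m))
          + |lam (t + c)| * (|deriv (deriv θ) (t / m)| / m / m) := by
          refine (abs_add_three _ _ _).trans (le_of_eq ?_)
          simp only [abs_mul, abs_div, abs_of_pos hm0, abs_two]
      _ ≤ (4 * W / m ^ 2) * (T + 1) + 2 * ((2 * W / m) * (T / m)) + W * (T / m / m) := by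
          gcongr
          · exact h2.trans i2
          · exact h1.trans i1
      _ = _ := by field_simp; ring

theorem shiftedMask_deriv_eq_zero_of_inner (hθ : IsCutoff θ) {m t : ℝ} (hm : 0 < m)
    (ht : |t| < m / 2) (c : ℝ) :
    shiftedMask θ lam 1 c m t = 0 ∧ deriv (deriv (shiftedMask θ lam 1 c m)) t = 0 := by
  set U : Set ℝ := {t | |t| < m / 2} with hU'
  have hU : IsOpen U := isOpen_lt continuous_abs continuous_const
  have h0 : ∀ s ∈ U, shiftedMask θ lam 1 c m s = 0 := fun s hs => by
    obtain ⟨h1, h2⟩ := abs_lt.1 (show |s| < m / 2 from hs)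
    rw [shiftedMask, hθ.eq_one, sub_self, mul_zero]
    constructor
    · rw [le_div_iff₀ hm]; linarith
    · rw [div_le_iff₀ hm]; linarith
  exact ⟨h0 t ht, deriv_eq_zero_of_isOpen hU (fun s hs => deriv_eq_zero_of_isOpen hU h0 hs) ht⟩

theorem shiftedMask_eq_zero_of_outer (hθ : IsCutoff θ) {m t : ℝ} (hm : 0 < m)
    (ht : m ≤ |t|) (c : ℝ) : shiftedMask θ lam 0 c m t = 0 := by
  rw [shiftedMask, hθ.eq_zero, sub_self, mul_zero]
  rintro ⟨h1, h2⟩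
  rw [lt_div_iff₀ hm] at h1
  rw [div_lt_iff₀ hm] at h2
  exact absurd (abs_lt.2 ⟨by linarith, by linarith⟩) (not_lt.2 ht)

theorem shiftedMask_deriv_eq_zero_of_outer (hθ : IsCutoff θ) {m t : ℝ} (hm : 0 < m)
    (ht : m < |t|) (c : ℝ) : deriv (deriv (shiftedMask θ lam 0 c m)) t = 0 := by
  have hU : IsOpen {t : ℝ | m < |t|} := isOpen_lt continuous_const continuous_abs
  exact deriv_eq_zero_of_isOpen hU (fun s hs => deriv_eq_zero_of_isOpen hU
    (fun x hx => shiftedMask_eq_zero_of_outer hθ hm (le_of_lt hx) c) hs) ht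

end

/-! ### `L¹` norms of the alias kernels -/

/-- The Fourier multiplier of the `j`-th alias of the error of `opQ`. -/
noncomputable def aliasCoeff (θ lam : ℝ → ℝ) (m : ℕ) (j l : ℤ) : ℝ :=
  shiftedMask θ lam (if j = 0 then 1 else 0) ((2 * m + 1) * j) m l

theorem abs_secondDiff_le {h : ℝ → ℝ} (hh : ContDiff ℝ 2 h) {B : ℝ} {l : ℤ}
    (hB : ∀ t : ℝ, |t - l| ≤ 1 → |deriv (deriv h) t| ≤ B) :
    |secondDiff (fun k : ℤ => h k) l| ≤ B := by
  have := abs_second_difference_le hh hB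
  simpa [secondDiff] using this

section

variable {θ lam : ℝ → ℝ} {r κ : ℝ}

theorem exists_aliasCoeff_zero_bound (hr : 1 < r) (hθ : IsCutoff θ) (hlam : IsMask r κ lam) :
    ∃ C : ℝ, 0 < C ∧ ∀ m : ℕ, 1 ≤ m →
      ∫⁻ x, ‖trigSeries (aliasCoeff θ lam m 0) x‖ₑ ∂haar ≤ ENNReal.ofReal (C * weight r κ m) := by
  obtain ⟨C₁, hC₁, h₁⟩ := exists_shiftedMask_bounds (by linarith) hθ hlam
  obtain ⟨C₂, hC₂, h₂⟩ := exists_weight_comparable κ hr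
  obtain ⟨C₃, hC₃, h₃⟩ := exists_tsum_weight_le κ hr
  refine ⟨4 * (C₁ * C₂ * C₂ * C₃ + C₁ * C₂ * C₃), by positivity, fun m hm => ?_⟩
  have hm1 : (1 : ℝ) ≤ m := by exact_mod_cast hm
  have hm0 : (0 : ℝ) < m := by linarith
  have hwm := weight_pos r κ hm0
  have hb : ∀ t : ℝ, |shiftedMask θ lam 1 0 m t| ≤ C₁ * C₂ * weight r κ (m + |t|) ∧
      |deriv (deriv (shiftedMask θ lam 1 0 m)) t| ≤ C₁ * C₂ * weight r κ (m + |t|) / m ^ 2 := by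
    intro t
    have hw := weight_pos r κ (by positivity : 0 < m + |t|)
    rcases lt_or_ge |t| (m / 2) with ht | ht
    · obtain ⟨e0, e2⟩ := shiftedMask_deriv_eq_zero_of_inner (lam := lam) hθ hm0 ht 0
      rw [e0, e2, abs_zero]
      constructor <;> positivity
    · obtain ⟨b0, b2⟩ := h₁ m 1 0 t hm1 (by norm_num) (by simpa using ht)
      rw [add_zero] at b0 b2
      have hc := h₂ (m + |t|) |t| (by linarith) (by linarith) (by linarith)
      have : C₁ * weight r κ |t| ≤ C₁ * C₂ * weight r κ (m + |t|) := by
        rw [mul_assoc]; gcongr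
      exact ⟨b0.trans this, b2.trans (by gcongr)⟩
  obtain ⟨S, hS, hSle⟩ := h₃ m hm1
  -- The second difference at `l` sees points `t` with `|t - l| ≤ 1`; moving the weight from `t`
  -- back to `l` costs the extra factor `C₂`.
  have hM := hS.mul_left (C₁ * C₂ * C₂ + C₁ * C₂)
  have hco : aliasCoeff θ lam m 0 = fun l : ℤ => shiftedMask θ lam 1 0 m l := by
    funext l; simp [aliasCoeff]
  rw [hco]
  refine (lintegral_enorm_trigSeries_le_of_majorant hm0 hM (fun l => ?_) (fun l => ?_)).trans
    (ENNReal.ofReal_le_ofReal ?_)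
  · have hw := weight_pos r κ (by positivity : 0 < m + |(l : ℝ)|)
    refine (hb l).1.trans ?_
    have : 0 ≤ C₁ * C₂ * C₂ * weight r κ (m + |(l : ℝ)|) := by positivity
    linarith
  · have hw := weight_pos r κ (by positivity : 0 < m + |(l : ℝ)|)
    refine abs_secondDiff_le (contDiff_shiftedMask hθ.contDiff hlam.contDiff _ _ _)
      fun t ht => (hb t).2.trans ?_
    have hlt : |(l : ℝ)| ≤ |t| + 1 := by
      have := abs_sub_abs_le_abs_sub (l : ℝ) t
      rw [abs_sub_comm] at this
      linarith
    have hc := h₂ (m + |(l : ℝ)|) (m + |t|) (by linarith [abs_nonneg (l : ℝ)])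
      (by linarith [abs_nonneg t]) (by linarith [abs_nonneg t])
    refine div_le_div_of_nonneg_right ?_ (by positivity)
    calc C₁ * C₂ * weight r κ (m + |t|) ≤ C₁ * C₂ * (C₂ * weight r κ (m + |(l : ℝ)|)) := by gcongr
      _ ≤ C₁ * C₂ * (C₂ * weight r κ (m + |(l : ℝ)|)) + C₁ * C₂ * weight r κ (m + |(l : ℝ)|) := by
          have : 0 ≤ C₁ * C₂ * weight r κ (m + |(l : ℝ)|) := by positivity
          linarith
      _ = _ := by ring
  · calc 4 * ((C₁ * C₂ * C₂ + C₁ * C₂) * S / m)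
        ≤ 4 * ((C₁ * C₂ * C₂ + C₁ * C₂) * (C₃ * m * weight r κ m) / m) := by gcongr
      _ = _ := by field_simp

theorem aliasCoeff_eq_zero (hθ : IsCutoff θ) {m : ℕ} (hm : 1 ≤ m) {j l : ℤ} (hj : j ≠ 0)
    (hl : (m : ℤ) ≤ |l|) : aliasCoeff θ lam m j l = 0 := by
  rw [aliasCoeff, if_neg hj]
  exact shiftedMask_eq_zero_of_outer hθ (by exact_mod_cast hm) (by exact_mod_cast hl) _

theorem exists_aliasCoeff_bound (hr : 1 < r) (hθ : IsCutoff θ) (hlam : IsMask r κ lam) :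
    ∃ C : ℝ, 0 < C ∧ ∀ m : ℕ, 1 ≤ m → ∀ j : ℤ, j ≠ 0 →
      ∫⁻ x, ‖trigSeries (aliasCoeff θ lam m j) x‖ₑ ∂haar ≤
        ENNReal.ofReal (C * (weight r κ m * |(j : ℝ)| ^ (-((r + 1) / 2)))) := by
  obtain ⟨C₁, hC₁, h₁⟩ := exists_shiftedMask_bounds (by linarith) hθ hlam
  obtain ⟨C₂, hC₂, h₂⟩ := exists_weight_comparable κ hr
  obtain ⟨C₃, hC₃, h₃⟩ := exists_weight_le_rpow κ hr
  refine ⟨12 * (C₁ * C₂ * C₃), by positivity, fun m hm j hj => ?_⟩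
  have hm1 : (1 : ℝ) ≤ m := by exact_mod_cast hm
  have hm0 : (0 : ℝ) < m := by linarith
  have hj1 : (1 : ℝ) ≤ |(j : ℝ)| := by exact_mod_cast Int.one_le_abs hj
  have hmj : (m : ℝ) ≤ m * |(j : ℝ)| := by nlinarith
  have hw := weight_pos r κ (by linarith : 0 < m * |(j : ℝ)|)
  set c : ℝ := (2 * m + 1) * j with hc
  have hcabs : |c| = (2 * m + 1) * |(j : ℝ)| := by
    rw [hc, abs_mul, abs_of_pos (by positivity)]
  set W := C₁ * C₂ * weight r κ (m * |(j : ℝ)|) with hW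
  have hW0 : 0 ≤ W := by positivity
  have hb : ∀ t : ℝ, |t| ≤ m → |shiftedMask θ lam 0 c m t| ≤ W ∧
      |deriv (deriv (shiftedMask θ lam 0 c m)) t| ≤ W / m ^ 2 := by
    intro t ht
    -- For `|t| ≤ m`, `|t + c| ≥ (2m+1)|j| - m ≥ m|j|` because `|j| ≥ 1`.
    have hlow : m * |(j : ℝ)| ≤ |t + c| := by
      have := abs_sub_abs_le_abs_sub c (-t)
      rw [abs_neg, sub_neg_eq_add, add_comm c, hcabs] at this
      nlinarith
    obtain ⟨b0, b2⟩ := h₁ m 0 c t hm1 (by norm_num) (by linarith)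
    have hcmp := h₂ (m * |(j : ℝ)|) |t + c| (by linarith) (by linarith) (by linarith)
    have : C₁ * weight r κ |t + c| ≤ W := by
      rw [hW, mul_assoc]; gcongr
    exact ⟨b0.trans this, b2.trans (by gcongr)⟩
  -- At `|l| = m` the second difference reaches beyond `[-m, m]`, where the function vanishes
  -- identically.
  have hb2 : ∀ t : ℝ, |deriv (deriv (shiftedMask θ lam 0 c m)) t| ≤ W / m ^ 2 := by
    intro t
    rcases le_or_gt |t| m with ht | ht
    · exact (hb t ht).2
    · rw [shiftedMask_deriv_eq_zero_of_outer hθ hm0 ht, abs_zero]; positivity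
  set s : Finset ℤ := Finset.Icc (-(m : ℤ)) m with hs
  have hmem : ∀ l : ℤ, l ∈ s ↔ |l| ≤ m := fun l => by rw [hs, Finset.mem_Icc, abs_le]
  have hM : HasSum (fun l : ℤ => if l ∈ s then W else 0) ((2 * m + 1) * W) := by
    have h : HasSum (fun l : ℤ => if l ∈ s then W else 0) (∑ l ∈ s, if l ∈ s then W else 0) :=
      hasSum_sum_of_ne_finset_zero fun l hl => if_neg hl
    rw [Finset.sum_congr rfl fun l hl => if_pos hl, Finset.sum_const, nsmul_eq_mul] at h
    convert h using 2
    rw [hs, Int.card_Icc]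
    have : ((m : ℤ) + 1 - -(m : ℤ)).toNat = 2 * m + 1 := by omega
    rw [this]; push_cast; ring
  have hco : aliasCoeff θ lam m j = fun l : ℤ => shiftedMask θ lam 0 c m l := by
    funext l; simp [aliasCoeff, hj, hc]
  refine (lintegral_enorm_trigSeries_le_of_majorant hm0 hM (fun l => ?_) (fun l => ?_)).trans
    (ENNReal.ofReal_le_ofReal ?_)
  · by_cases hl : l ∈ s
    · rw [if_pos hl, hco]
      exact (hb l (by exact_mod_cast (hmem l).1 hl)).1
    · rw [if_neg hl, aliasCoeff_eq_zero hθ hm hj, abs_zero]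
      rw [hmem] at hl; omega
  · by_cases hl : l ∈ s
    · rw [if_pos hl, hco]
      exact abs_secondDiff_le (contDiff_shiftedMask hθ.contDiff hlam.contDiff _ _ _)
        fun t _ => hb2 t
    -- For `|l| > m` all three indices `l - 1`, `l`, `l + 1` have modulus at least `m`, where the
    -- cutoff is zero.
    · rw [if_neg hl, zero_div]
      rw [hmem, not_le, lt_abs] at hl
      have z : ∀ k : ℤ, (m : ℤ) ≤ |k| → aliasCoeff θ lam m j k = 0 := fun k =>
        aliasCoeff_eq_zero hθ hm hj
      rw [secondDiff, z (l + 1) (by rw [le_abs]; omega), z l (by rw [le_abs]; omega),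
        z (l - 1) (by rw [le_abs]; omega)]
      simp
  · have hd := h₃ m (m * |(j : ℝ)|) (by linarith) hmj
    rw [mul_div_cancel_left₀ _ hm0.ne'] at hd
    calc 4 * ((2 * m + 1) * W / m) ≤ 4 * ((3 * m) * W / m) := by gcongr; linarith
      _ = 12 * (C₁ * C₂) * weight r κ (m * |(j : ℝ)|) := by rw [hW]; field_simp; ring
      _ ≤ 12 * (C₁ * C₂) * (C₃ * |(j : ℝ)| ^ (-((r + 1) / 2)) * weight r κ m) := by gcongr
      _ = _ := by ring

/-- The `L¹` norms of all alias kernels are summable with the expected rate. -/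
theorem exists_tsum_lintegral_alias_le (hr : 1 < r) (hθ : IsCutoff θ) (hlam : IsMask r κ lam) :
    ∃ C : ℝ, 0 < C ∧ ∀ m : ℕ, 1 ≤ m →
      ∑' j : ℤ, ∫⁻ x, ‖trigSeries (aliasCoeff θ lam m j) x‖ₑ ∂haar ≤
        ENNReal.ofReal (C * weight r κ m) := by
  obtain ⟨C₀, hC₀, h₀⟩ := exists_aliasCoeff_zero_bound hr hθ hlam
  obtain ⟨C₁, hC₁, h₁⟩ := exists_aliasCoeff_bound hr hθ hlam
  have hsum : Summable fun j : ℤ => |(j : ℝ)| ^ (-((r + 1) / 2)) :=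
    Real.summable_abs_int_rpow (by linarith)
  refine ⟨C₀ + C₁ * ∑' j : ℤ, |(j : ℝ)| ^ (-((r + 1) / 2)), ?_, fun m hm => ?_⟩
  · have : 0 ≤ ∑' j : ℤ, |(j : ℝ)| ^ (-((r + 1) / 2)) := tsum_nonneg fun j => by positivity
    positivity
  have hm0 : (0 : ℝ) < m := by exact_mod_cast hm
  have hwm := weight_pos r κ hm0
  have hs1 := hsum.mul_left (C₁ * weight r κ m)
  have hs0 : HasSum (fun j : ℤ => if j = 0 then C₀ * weight r κ m else 0) (C₀ * weight r κ m) :=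
    hasSum_ite_eq 0 _
  calc _ ≤ ∑' j : ℤ, ENNReal.ofReal ((if j = 0 then C₀ * weight r κ m else 0)
          + C₁ * weight r κ m * |(j : ℝ)| ^ (-((r + 1) / 2))) := by
        refine ENNReal.tsum_le_tsum fun j => ?_
        by_cases hj : j = 0
        · subst hj
          refine (h₀ m hm).trans (ENNReal.ofReal_le_ofReal ?_)
          rw [if_pos rfl]
          have : 0 ≤ C₁ * weight r κ m * |((0 : ℤ) : ℝ)| ^ (-((r + 1) / 2)) := by positivity
          linarith
        · refine (h₁ m hm j hj).trans (le_of_eq ?_)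
          rw [if_neg hj, zero_add, mul_assoc]
    _ = ENNReal.ofReal (∑' j : ℤ, ((if j = 0 then C₀ * weight r κ m else 0)
          + C₁ * weight r κ m * |(j : ℝ)| ^ (-((r + 1) / 2)))) := by
        rw [ENNReal.ofReal_tsum_of_nonneg _ (hs0.summable.add hs1)]
        intro j
        split_ifs <;> positivity
    _ = _ := by
        rw [hs0.summable.tsum_add hs1, hs0.tsum_eq, tsum_mul_left]
        congr 1; ring

end

/-! ### Aliasing identity for the quadrature -/

/-- Convolution with a trigonometric series acts as a Fourier multiplier. -/
theorem conv_trigSeries {a : ℤ → ℝ} (ha : Summable a) {g : Torus → ℂ} (hg : Integrable g haar)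
    (x : Torus) :
    conv (trigSeries a) g x = ∑' k : ℤ, (a k : ℂ) * fourierCoeff g k * fourier k x := by
  have h1 : conv (trigSeries a) g x =
      ∫ t, ∑' k : ℤ, (a k : ℂ) * fourier k (x - t) * g t ∂haar := by
    rw [conv, convolution_eq_swap]
    refine integral_congr_ae (Filter.Eventually.of_forall fun t => ?_)
    simp only [ContinuousLinearMap.mul_apply', trigSeries]
    rw [tsum_mul_right]
  have hint : ∀ k : ℤ, Integrable (fun t => (a k : ℂ) * fourier k (x - t) * g t) haar := by
    intro k
    refine hg.bdd_mul (c := |a k|) ?_ ?_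
    · exact (by fun_prop : Continuous fun t : Torus =>
        (a k : ℂ) * fourier k (x - t)).aestronglyMeasurable
    · exact Filter.Eventually.of_forall fun t => (norm_coeff_mul_fourier _ _ _).le
  rw [h1, ← integral_tsum_of_summable_integral_norm hint]
  · refine tsum_congr fun k => ?_
    have : ∀ t, (a k : ℂ) * fourier k (x - t) * g t =
        ((a k : ℂ) * fourier k x) * (fourier (-k) t • g t) := by
      intro t
      have : (fourier k (x - t) : ℂ) = fourier k x * fourier (-k) t := by
        simp [fourier_apply, sub_eq_add_neg, toCircle_add]
      rw [this, smul_eq_mul]; ring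
    simp_rw [this]
    rw [integral_const_mul, fourierCoeff]; ring
  · have : ∀ k : ℤ, ∫ t, ‖(a k : ℂ) * fourier k (x - t) * g t‖ ∂haar =
        |a k| * ∫ t, ‖g t‖ ∂haar := by
      intro k
      rw [← integral_const_mul]
      congr 1; ext t; rw [norm_mul, norm_coeff_mul_fourier]
    simp_rw [this]
    exact ha.abs.mul_right _

theorem enorm_conv_le (h g : Torus → ℂ) (x : Torus) :
    ‖conv h g x‖ₑ ≤ ∫⁻ t, ‖h (x - t)‖ₑ * ‖g t‖ₑ ∂haar := by
  rw [conv, convolution_eq_swap]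
  refine (enorm_integral_le_lintegral_enorm _).trans (le_of_eq (lintegral_congr fun t => ?_))
  rw [ContinuousLinearMap.mul_apply', enorm_mul]

/-- A geometric sum of powers of a root of unity of order dividing `2m + 1`. -/
theorem sum_fourier_node (m : ℕ) (n : ℤ) :
    ∑ k ∈ Finset.range (2 * m + 1), (fourier n (node m k) : ℂ) =
      if ((2 * m + 1 : ℕ) : ℤ) ∣ n then (2 * m + 1 : ℂ) else 0 := by
  have hN : (2 * m + 1 : ℂ) ≠ 0 := by exact_mod_cast (2 * m).succ_ne_zero
  have hpi : (Real.pi : ℂ) ≠ 0 := by exact_mod_cast Real.pi_ne_zero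
  set z : ℂ := Complex.exp (2 * Real.pi * Complex.I * n / (2 * m + 1)) with hz
  have hpow : ∀ k : ℕ, (fourier n (node m k) : ℂ) = z ^ k := by
    intro k
    rw [node, fourier_coe_apply, hz, ← Complex.exp_nat_mul]
    congr 1
    push_cast
    field_simp
  have hz1 : z = 1 ↔ ((2 * m + 1 : ℕ) : ℤ) ∣ n := by
    rw [hz, Complex.exp_eq_one_iff]
    refine exists_congr fun k => ?_
    constructor
    · intro h
      have h2 : (n : ℂ) = (2 * m + 1) * k := by
        have h0 : (2 * Real.pi * Complex.I : ℂ) ≠ 0 := by simp [hpi]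
        refine mul_left_cancel₀ h0 ?_
        rw [div_eq_iff hN] at h
        rw [h]; ring
      exact_mod_cast h2
    · intro h
      rw [h]
      push_cast
      field_simp
  simp_rw [hpow]
  split_ifs with h
  · rw [hz1.2 h]; simp
  · rw [geom_sum_eq (fun h1 => h (hz1.1 h1))]
    have : z ^ (2 * m + 1) = 1 := by
      rw [hz, ← Complex.exp_nat_mul, Complex.exp_eq_one_iff]
      refine ⟨n, ?_⟩
      push_cast
      field_simp
    rw [this, sub_self, zero_div]

section

variable {θ lam : ℝ → ℝ}

theorem cutoff_div_eq_zero (hθ : IsCutoff θ) {m : ℕ} (hm : 1 ≤ m) {l : ℤ}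
    (hl : l ∉ Finset.Icc (-(m : ℤ)) m) : θ (l / m) = 0 := by
  have hm0 : (0 : ℝ) < m := by exact_mod_cast hm
  refine hθ.eq_zero _ fun h => hl ?_
  obtain ⟨h1, h2⟩ := h
  rw [lt_div_iff₀ hm0] at h1
  rw [div_lt_iff₀ hm0] at h2
  have h1' : -(m : ℤ) < l := by
    have : (-(m : ℝ)) < l := by linarith
    exact_mod_cast this
  have h2' : l < (m : ℤ) := by
    have : (l : ℝ) < m := by linarith
    exact_mod_cast this
  exact Finset.mem_Icc.2 ⟨h1'.le, h2'.le⟩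

theorem aliasCoeff_eq (θ lam : ℝ → ℝ) (m : ℕ) (j l : ℤ) :
    aliasCoeff θ lam m j l = lam ((l + ((2 * m + 1 : ℕ) : ℤ) * j : ℤ) : ℝ) * θ (l / m)
      - if j = 0 then lam l else 0 := by
  have h : ((l + ((2 * m + 1 : ℕ) : ℤ) * j : ℤ) : ℝ) = l + (2 * m + 1) * j := by push_cast; ring
  rw [aliasCoeff, shiftedMask, h]
  split_ifs with hj
  · subst hj; simp; ring
  · ring

theorem summable_aliasCoeff (hθ : IsCutoff θ) (hs : Summable fun k : ℤ => lam k) {m : ℕ}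
    (hm : 1 ≤ m) (j : ℤ) : Summable (aliasCoeff θ lam m j) := by
  rw [funext (aliasCoeff_eq θ lam m j)]
  refine Summable.sub (summable_of_ne_finset_zero (s := Finset.Icc (-(m : ℤ)) m)
    fun l hl => ?_) ?_
  · rw [cutoff_div_eq_zero hθ hm hl, mul_zero]
  · split_ifs
    · exact hs
    · exact summable_zero

/-- Convolution with `kernelH` when both masks agree. -/
theorem opV_eq_sum (hθ : IsCutoff θ) (h0 : ∀ x, lam x ≠ 0) {m : ℕ} (hm : 1 ≤ m)
    {g : Torus → ℂ} (hg : Integrable g haar) (x : Torus) :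
    opV θ lam lam m g x =
      ∑ l ∈ Finset.Icc (-(m : ℤ)) m, (θ (l / m) : ℂ) * fourierCoeff g l * fourier l x := by
  have hker : kernelH θ lam lam m = trigSeries fun l : ℤ => θ (l / m) := by
    funext y
    rw [kernelH, trigSeries]
    refine tsum_congr fun k => ?_
    rw [div_self (h0 _), mul_one]
  have hsum : Summable fun l : ℤ => θ (l / m) :=
    summable_of_ne_finset_zero fun l hl => cutoff_div_eq_zero hθ hm hl
  rw [opV, hker, conv_trigSeries hsum hg]
  refine tsum_eq_sum fun l hl => ?_
  rw [cutoff_div_eq_zero hθ hm hl]; simp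

/-- Aliasing: by orthogonality on the nodes, only the frequencies `n ≡ l` mod `2m + 1` of `φ_lam`
survive. -/
theorem sum_fourier_node_mul_phi (hs : Summable fun k : ℤ => lam k) (m : ℕ) (l : ℤ)
    (x : Torus) :
    1 / (2 * m + 1) * ∑ k ∈ Finset.range (2 * m + 1),
        (fourier l (node m k) : ℂ) * phi lam (x - node m k) =
      ∑' j : ℤ, (lam ((l + ((2 * m + 1 : ℕ) : ℤ) * j : ℤ) : ℝ) : ℂ) *
        fourier (l + ((2 * m + 1 : ℕ) : ℤ) * j) x := by
  have hN : (2 * m + 1 : ℂ) ≠ 0 := by exact_mod_cast (2 * m).succ_ne_zero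
  have hN' : ((2 * m + 1 : ℕ) : ℤ) ≠ 0 := by positivity
  have hterm : ∀ k, (fourier l (node m k) : ℂ) * phi lam (x - node m k) =
      ∑' n : ℤ, (lam n : ℂ) * fourier n x * fourier (l - n) (node m k) := by
    intro k
    rw [phi, ← tsum_mul_left]
    refine tsum_congr fun n => ?_
    have e1 : (fourier n (x - node m k) : ℂ) = fourier n x * fourier (-n) (node m k) := by
      simp [fourier_apply, sub_eq_add_neg, toCircle_add]
    rw [e1, sub_eq_add_neg l n, fourier_add]
    ring
  have hsum : ∀ k ∈ Finset.range (2 * m + 1),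
      Summable fun n : ℤ => (lam n : ℂ) * fourier n x * fourier (l - n) (node m k) := by
    intro k _
    refine Summable.of_norm ?_
    simp only [norm_mul, norm_fourier_apply, mul_one, Complex.norm_real]
    exact hs.norm
  simp_rw [hterm]
  rw [← Summable.tsum_finsetSum hsum, ← tsum_mul_left]
  have hval : ∀ n : ℤ, 1 / (2 * m + 1 : ℂ) * ∑ k ∈ Finset.range (2 * m + 1),
      (lam n : ℂ) * fourier n x * fourier (l - n) (node m k) =
      if ((2 * m + 1 : ℕ) : ℤ) ∣ l - n then (lam n : ℂ) * fourier n x else 0 := by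
    intro n
    rw [← Finset.mul_sum, sum_fourier_node]
    split_ifs
    · field_simp
    · simp
  simp_rw [hval]
  have hinj : Function.Injective fun j : ℤ => l + ((2 * m + 1 : ℕ) : ℤ) * j := fun i j h =>
    mul_left_cancel₀ hN' (add_left_cancel h)
  rw [← hinj.tsum_eq]
  · refine tsum_congr fun j => ?_
    rw [if_pos ⟨-j, by ring⟩]
  · intro n hn
    have hd : ((2 * m + 1 : ℕ) : ℤ) ∣ l - n := by
      by_contra h
      exact hn (if_neg h)
    obtain ⟨c, hc⟩ := hd
    exact ⟨-c, by simp only [mul_neg, ← hc, neg_sub, add_sub_cancel]⟩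

/-- The error of the quadrature operator as a sum over its aliases. -/
theorem quadrature_sub_conv_eq_tsum (hθ : IsCutoff θ) (hs : Summable fun k : ℤ => lam k)
    (h0 : ∀ x, lam x ≠ 0) {m : ℕ} (hm : 1 ≤ m) {g : Torus → ℂ} (hg : Integrable g haar)
    (x : Torus) :
    1 / (2 * m + 1) * ∑ k ∈ Finset.range (2 * m + 1),
        opV θ lam lam m g (node m k) * phi lam (x - node m k) - conv (phi lam) g x =
      ∑' j : ℤ, fourier (((2 * m + 1 : ℕ) : ℤ) * j) x *
        conv (trigSeries (aliasCoeff θ lam m j)) g x := by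
  set N : ℤ := ((2 * m + 1 : ℕ) : ℤ) with hN
  have hN0 : N ≠ 0 := by positivity
  set s := Finset.Icc (-(m : ℤ)) m with hsdef
  set b : ℤ → ℤ → ℂ := fun l j =>
    (θ (l / m) : ℂ) * fourierCoeff g l * ((lam ((l + N * j : ℤ) : ℝ) : ℂ) * fourier (l + N * j) x)
    with hb
  have hbs : ∀ l, Summable (b l) := by
    intro l
    have hinj : Function.Injective fun j : ℤ => l + N * j := fun i j h =>
      mul_left_cancel₀ hN0 (add_left_cancel h)
    exact ((summable_coeff_mul_fourier hs x).comp_injective hinj).mul_left _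
  have hP : conv (phi lam) g x =
      ∑' k : ℤ, (lam k : ℂ) * fourierCoeff g k * fourier k x := conv_trigSeries hs hg x
  have hQ : 1 / (2 * m + 1) * ∑ k ∈ Finset.range (2 * m + 1),
        opV θ lam lam m g (node m k) * phi lam (x - node m k) = ∑' j, ∑ l ∈ s, b l j := by
    rw [Summable.tsum_finsetSum fun l _ => hbs l]
    simp_rw [opV_eq_sum hθ h0 hm hg, Finset.sum_mul]
    rw [Finset.sum_comm, Finset.mul_sum]
    refine Finset.sum_congr rfl fun l _ => ?_
    rw [hb, tsum_mul_left, ← sum_fourier_node_mul_phi hs, Finset.mul_sum, Finset.mul_sum,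
      Finset.mul_sum]
    refine Finset.sum_congr rfl fun k _ => ?_
    ring
  -- The factor `e^{iNjx}` carries frequency `l` of the kernel to `l + N j`; the subtracted `φ_lam *
  -- g` is assigned wholly to `j = 0`.
  have hterm : ∀ j, fourier (N * j) x * conv (trigSeries (aliasCoeff θ lam m j)) g x =
      ∑ l ∈ s, b l j - if j = 0 then conv (phi lam) g x else 0 := by
    intro j
    set d : ℤ → ℂ := fun l =>
      ((lam ((l + N * j : ℤ) : ℝ) * θ (l / m) : ℝ) : ℂ) * fourierCoeff g l * fourier l x with hd
    have hd0 : ∀ l ∉ s, d l = 0 := fun l hl => by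
      simp only [hd]; rw [cutoff_div_eq_zero hθ hm hl]; simp
    have hds : Summable d := summable_of_ne_finset_zero hd0
    have hmain : fourier (N * j) x * ∑' l, d l = ∑ l ∈ s, b l j := by
      rw [tsum_eq_sum hd0, Finset.mul_sum]
      refine Finset.sum_congr rfl fun l _ => ?_
      simp only [hb, hd]
      rw [fourier_add]
      push_cast
      ring
    rw [conv_trigSeries (summable_aliasCoeff hθ hs hm j) hg]
    by_cases hj : j = 0
    · subst hj
      have hps : Summable fun k : ℤ => (lam k : ℂ) * fourierCoeff g k * fourier k x := by
        refine Summable.of_norm_bounded (hs.abs.mul_right (∫ t, ‖g t‖ ∂haar)) fun k => ?_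
        rw [norm_mul, norm_mul, norm_fourier_apply, mul_one, Complex.norm_real, Real.norm_eq_abs]
        refine mul_le_mul_of_nonneg_left ?_ (abs_nonneg _)
        refine (norm_integral_le_integral_norm _).trans (le_of_eq ?_)
        congr 1; ext t; rw [norm_smul, norm_fourier_apply, one_mul]
      rw [if_pos rfl, ← hmain, hP]
      simp only [mul_zero, fourier_zero, one_mul]
      rw [← hds.tsum_sub hps]
      refine tsum_congr fun l => ?_
      rw [aliasCoeff_eq, if_pos rfl]
      simp only [hd]
      push_cast
      ring_nf
    · rw [if_neg hj, sub_zero, ← hmain]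
      congr 1
      refine tsum_congr fun l => ?_
      rw [aliasCoeff_eq, if_neg hj, sub_zero]
  simp_rw [hterm]
  rw [hQ, (summable_sum fun l _ => hbs l).tsum_sub (hasSum_ite_eq 0 _).summable, tsum_ite_eq]

/-! ### Error estimate and conclusion -/

/-- The modulations disappear under absolute values, so all aliases combine into the one kernel `∑_j
|T_j|` and Young's inequality is used once. -/
theorem eLpNorm_conv_sub_quadrature_le {p : ℝ≥0∞} (hp : 1 ≤ p) (hθ : IsCutoff θ)
    (hs : Summable fun k : ℤ => lam k) (h0 : ∀ x, lam x ≠ 0) {m : ℕ} (hm : 1 ≤ m)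
    (hfin : ∑' j : ℤ, ∫⁻ x, ‖trigSeries (aliasCoeff θ lam m j) x‖ₑ ∂haar ≠ ∞)
    {g : Torus → ℂ} (hgm : StronglyMeasurable g) (hg : Integrable g haar) {f : Torus → ℂ}
    (hf : f =ᵐ[haar] conv (phi lam) g) :
    eLpNorm (fun x => f x - 1 / (2 * m + 1) * ∑ k ∈ Finset.range (2 * m + 1),
        opV θ lam lam m g (node m k) * phi lam (x - node m k)) p haar ≤
      (∑' j : ℤ, ∫⁻ x, ‖trigSeries (aliasCoeff θ lam m j) x‖ₑ ∂haar) * eLpNorm g p haar := by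
  have hcont : ∀ j, Measurable fun x => ‖trigSeries (aliasCoeff θ lam m j) x‖ₑ := fun j =>
    (continuous_trigSeries (summable_aliasCoeff hθ hs hm j)).measurable.enorm
  have hΦ : Measurable fun x => ∑' j, ‖trigSeries (aliasCoeff θ lam m j) x‖ₑ :=
    Measurable.tsum hcont
  have hint : ∑' j : ℤ, ∫⁻ x, ‖trigSeries (aliasCoeff θ lam m j) x‖ₑ ∂haar =
      ∫⁻ x, ∑' j : ℤ, ‖trigSeries (aliasCoeff θ lam m j) x‖ₑ ∂haar :=
    (lintegral_tsum fun j => (hcont j).aemeasurable).symm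
  rw [hint] at hfin ⊢
  refine eLpNorm_le_of_enorm_le_lintegral hp hgm hΦ hfin ?_
  filter_upwards [hf] with x hx
  rw [hx, ← neg_sub, enorm_neg, quadrature_sub_conv_eq_tsum hθ hs h0 hm hg]
  refine enorm_tsum_le_tsum_enorm.trans ?_
  calc ∑' j : ℤ, ‖fourier (((2 * m + 1 : ℕ) : ℤ) * j) x *
          conv (trigSeries (aliasCoeff θ lam m j)) g x‖ₑ
      ≤ ∑' j : ℤ, ∫⁻ t, ‖trigSeries (aliasCoeff θ lam m j) (x - t)‖ₑ * ‖g t‖ₑ ∂haar := by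
        refine ENNReal.tsum_le_tsum fun j => ?_
        rw [enorm_mul, ← ofReal_norm, norm_fourier_apply, ENNReal.ofReal_one, one_mul]
        exact enorm_conv_le _ _ _
    _ = ∫⁻ t, ∑' j : ℤ, ‖trigSeries (aliasCoeff θ lam m j) (x - t)‖ₑ * ‖g t‖ₑ ∂haar := by
        refine (lintegral_tsum fun j => ?_).symm
        have : Measurable fun t => ‖trigSeries (aliasCoeff θ lam m j) (x - t)‖ₑ :=
          (hcont j).comp (measurable_const.sub measurable_id)
        exact (this.mul hgm.measurable.enorm).aemeasurable
    _ = _ := by simp_rw [ENNReal.tsum_mul_right]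

end

theorem log_add_one_rpow_le (κ : ℝ) {x : ℝ} (hx : 2 ≤ x) :
    Real.log (x + 1) ^ (-κ) ≤ 2 ^ |κ| * Real.log x ^ (-κ) := by
  have hL : 0 < Real.log x := Real.log_pos (by linarith)
  have hle : Real.log x ≤ Real.log (x + 1) := Real.log_le_log (by linarith) (by linarith)
  rcases le_total 0 κ with hκ | hκ
  · have h1 : Real.log (x + 1) ^ (-κ) ≤ Real.log x ^ (-κ) :=
      Real.rpow_le_rpow_of_nonpos hL hle (by linarith)
    have h2 : (1 : ℝ) ≤ 2 ^ |κ| := Real.one_le_rpow (by norm_num) (abs_nonneg _)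
    have h3 : 0 ≤ Real.log x ^ (-κ) := by positivity
    nlinarith
  · have h2 : Real.log (x + 1) ≤ 2 * Real.log x := by
      rw [← Real.log_rpow (by linarith)]
      refine Real.log_le_log (by linarith) ?_
      rw [Real.rpow_two]
      nlinarith
    rw [abs_of_nonpos hκ, ← Real.mul_rpow (by norm_num) hL.le]
    exact Real.rpow_le_rpow (by linarith) h2 (by linarith)

end TranslateApprox

open TranslateApprox in
theorem mainTheorem2 (p : ENNReal) (hp : 1 ≤ p) (r κ : ℝ) (hr : 1 < r)
    (θ : ℝ → ℝ) (hθ : IsCutoff θ)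
    (lam : ℝ → ℝ) (hlam0 : ∀ x : ℝ, lam x ≠ 0) (hlam : IsMask r κ lam) :
    ∃ c : ℝ, 0 < c ∧ ∀ f ∈ hSpace lam p, ∀ m : ℕ, 1 ≤ m →
      MeasureTheory.eLpNorm (fun x => f x - opQ θ lam lam m f x) p haar ≤
          ENNReal.ofReal
            (c * (m : ℝ) ^ (-r) * Real.log ((m : ℝ) + 1) ^ (-κ) * hNorm lam f) ∧
      (2 ≤ m →
        MeasureTheory.eLpNorm (fun x => f x - opQ θ lam lam m f x) p haar ≤
          ENNReal.ofReal
            (c * (m : ℝ) ^ (-r) * Real.log (m : ℝ) ^ (-κ) * hNorm lam f)) := by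
  obtain ⟨C, hC, h⟩ := exists_tsum_lintegral_alias_le hr hθ hlam
  have hA : (1 : ℝ) ≤ 2 ^ |κ| := Real.one_le_rpow (by norm_num) (abs_nonneg _)
  -- The factor `2 ^ |κ|` pays for replacing `log (m+1)` by `log m`, so one constant serves both
  -- estimates.
  refine ⟨C * 2 ^ |κ|, by positivity, fun f hf m hm => ?_⟩
  have hm0 : (0 : ℝ) < m := by exact_mod_cast hm
  have hgen : IsGenerator lam f (generator lam f) := by
    rw [generator, dif_pos hf]; exact hf.choose_spec
  have hn : 0 ≤ hNorm lam f := by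
    rw [hNorm, Lp.norm_def]; exact ENNReal.toReal_nonneg
  have hL : 0 ≤ Real.log ((m : ℝ) + 1) ^ (-κ) :=
    (Real.rpow_pos_of_pos (log_add_one_pos hm0) _).le
  have key : eLpNorm (fun x => f x - opQ θ lam lam m f x) p haar ≤
      ENNReal.ofReal (C * (m : ℝ) ^ (-r) * Real.log ((m : ℝ) + 1) ^ (-κ) * hNorm lam f) := by
    refine (eLpNorm_conv_sub_quadrature_le hp hθ (hlam.summable hr) hlam0 hm
      (ne_top_of_le_ne_top ENNReal.ofReal_ne_top (h m hm)) (Lp.stronglyMeasurable _)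
      ((Lp.memLp (generator lam f)).integrable hp) hgen).trans ?_
    have e : C * (m : ℝ) ^ (-r) * Real.log ((m : ℝ) + 1) ^ (-κ) * hNorm lam f =
        C * weight r κ m * hNorm lam f := by rw [weight]; ring
    rw [e, ENNReal.ofReal_mul (mul_pos hC (weight_pos r κ hm0)).le, hNorm, Lp.norm_def,
      ENNReal.ofReal_toReal (Lp.eLpNorm_ne_top _)]
    gcongr
    exact h m hm
  refine ⟨key.trans (ENNReal.ofReal_le_ofReal ?_),
    fun hm2 => key.trans (ENNReal.ofReal_le_ofReal ?_)⟩
  · gcongr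
    exact le_mul_of_one_le_right hC.le hA
  · have h2 := log_add_one_rpow_le κ (x := m) (by exact_mod_cast hm2)
    calc C * (m : ℝ) ^ (-r) * Real.log ((m : ℝ) + 1) ^ (-κ) * hNorm lam f
        ≤ C * (m : ℝ) ^ (-r) * (2 ^ |κ| * Real.log (m : ℝ) ^ (-κ)) * hNorm lam f := by gcongr
      _ = _ := by ring
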